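/- **Setting.** Let $1\le r\le K$ be integers. A graph on a vertex set $\mathcal V$ with $|\mathcal V|=n$ is undirected and may have self-loops. For every ordered pair $(i,j)$ with $\{i,j\}\in\mathcal E$ there is an intermediate value $v_{i,j}\in\{0,1\}^T$, Mapped from the file of $j$ and needed by the Reduce function of $i$. An allocation $A=(\mathcal M,\mathcal R)$ of computation load $r$ over $K$ machines consists of sets $\mathcal M_1,\dots,\mathcal M_K\subseteq\mathcal V$ with $\bigcup_k\mathcal M_k=\mathcal V$ and $\sum_k|\mathcal M_k|=rn$, and a partition $\mathcal V=\mathcal R_1\sqcup\dots\sqcup\mathcal R_K$ with $|\mathcal R_k|=n/K$ (so $K\mid n$). Let $\mathcal A(r)$ be the set of all these allocations, or the set of those for which moreover $|\mathcal M_k|=rn/K$ for every $k$; the theorem holds for either choice. In a Shuffle scheme for a graph $G$ and allocation $A$, machine $k$ multicasts a message of $c_k$ bits that is a function of its local values $\{v_{i,j}: j\in\mathcal M_k,\{i,j\}\in\mathcal E\}$; the scheme is feasible if, for all possible intermediate values, every machine $k$ can compute $\{v_{i,j}: i\in\mathcal R_k,\ j\notin\mathcal M_k,\ \{i,j\}\in\mathcal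 E\}$ from its local values and the messages of the other machines. Let $L_A(r,G)$ be the minimum of $\sum_k c_k/(n^2T)$ over all feasible schemes, and for a random graph $\mathcal G$ let $$L^*(r)=\inf_{A\in\mathcal A(r)}\mathbb E_{\mathcal G}[L_A(r,\mathcal G)].$$ In $\mathrm{SBM}(n_1,n_2,p,q)$, where $0<q<p\le1$, the vertices form two disjoint clusters of sizes $n_1,n_2$; independently over all unordered pairs $\{i,j\}$ (including $i=j$), the pair is an edge with probability $p$ if $i,j$ are in the same cluster and with probability $q$ otherwise. **Theorem.** Fix integers $1\le r\le K$. For each $n$ let $n_1+n_2=n$, $0<q<p\le1$ and $T\ge1$ be given (all depending on $n$), with $n_1=\Theta(n)$, $n_2=\Theta(n)$, $p=\omega(1/n^2)$ and $q=\omega(1/n^2)$, where $n\to\infty$ through the multiples of $K$. Then for $\mathrm{SBM}(n_1,n_2,p,q)$ $$\limsup_{n\to\infty}\ \frac{L^*(r)}{\dfrac{p n_1^2+p n_2^2+2q n_1n_2}{(n_1+n_2)^2}}\ \le\ \frac1r\Bigl(1-\frac rK\Bigr).$$ Moreover, for every $n\ge1$ divisible by $K$, $$\frac{L^*(r)}{q}\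 \ge\ \frac1r\Bigl(1-\frac rK\Bigr).$$ -/

import Mathlib

open Filter Topology

noncomputable section

namespace GraphMapReduce

/-- Binary words of length `T`. -/
abbrev Word (T : ℕ) : Type := Fin T → Bool

section Shuffle

variable {V : Type*} [Fintype V] [DecidableEq V] {K : ℕ}

/-- The intermediate values `v_{i,j}` of an undirected graph with edge set `E` (self-loops
allowed) are indexed by the ordered pairs `(i, j)` with `{i, j} ∈ E`: the value `v_{i,j}` is
Mapped from the file of `j` and is an input of the Reduce function of `i`. -/
abbrev ValueIdx (E : Finset (Sym2 V)) : Type _ := {e : V × V // s(e.1, e.2) ∈ E}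

/-- The intermediate values computed by a machine that stores the files of the vertices in `M`. -/
abbrev LocalIdx (E : Finset (Sym2 V)) (M : Finset V) : Type _ :=
  {e : ValueIdx E // e.1.2 ∈ M}

/-- The intermediate values which a machine with Mappers `M` and Reducers `R` must recover. -/
abbrev NeededIdx (E : Finset (Sym2 V)) (M R : Finset V) : Type _ :=
  {e : ValueIdx E // e.1.1 ∈ R ∧ e.1.2 ∉ M}

/-- A subgraph and computation allocation: machine `k` Maps the vertices in `M k` and
Reduces the vertices in `R k`. -/
structure Allocation (V : Type*) (K : ℕ) where
  M : Fin K → Finset V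
  R : Fin K → Finset V

/-- The allocations with computation load `r`: every vertex is Mapped somewhere,
`∑ₖ |M k| = r n`, and the sets `R k` partition the vertices into `K` parts of size `n / K`.
If `equal` holds, every machine must moreover Map the same number `r n / K` of vertices. -/
def allocations (V : Type*) [Fintype V] [DecidableEq V] (K r : ℕ) (equal : Prop) :
    Set (Allocation V K) :=
  {A | (∀ v, ∃ k, v ∈ A.M k) ∧
    ∑ k, (A.M k).card = r * Fintype.card V ∧
    (∀ k l, k ≠ l → Disjoint (A.R k) (A.R l)) ∧
    (∀ v, ∃ k, v ∈ A.R k) ∧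
    (∀ k, K * (A.R k).card = Fintype.card V) ∧
    (equal → ∀ k, K * (A.M k).card = r * Fintype.card V)}

/-- A feasible Shuffle coding scheme on the graph with edge set `E` for the allocation `A`
and intermediate values of `T` bits. Machine `k` multicasts a message of `len k` bits which is
a function of its local intermediate values, and recovers the values it needs from its local
values and the messages of the other machines, whatever the intermediate values are. -/
structure ShuffleScheme (E : Finset (Sym2 V)) (A : Allocation V K) (T : ℕ) where
  len : Fin K → ℕ
  encode : ∀ k, (LocalIdx E (A.M k) → Word T) → Word (len k)
  decode : ∀ k, (LocalIdx E (A.M k) → Word T) →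
    (∀ l : {l : Fin K // l ≠ k}, Word (len l)) → (NeededIdx E (A.M k) (A.R k) → Word T)
  correct : ∀ (v : ValueIdx E → Word T) (k : Fin K),
    decode k (fun e => v e.1) (fun l => encode l (fun e => v e.1)) = fun e => v e.1

/-- The minimum total number of bits of a feasible Shuffle coding scheme. -/
def minBits (E : Finset (Sym2 V)) (A : Allocation V K) (T : ℕ) : ℕ :=
  sInf {b | ∃ s : ShuffleScheme E A T, b = ∑ k, s.len k}

/-- The minimum normalized communication load `L_A(r, G)`. -/
def load (E : Finset (Sym2 V)) (A : Allocation V K) (T : ℕ) : ℝ :=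
  (minBits E A T : ℝ) / ((Fintype.card V : ℝ) ^ 2 * T)

end Shuffle

section RandomGraph

variable {V : Type*} [Fintype V] [DecidableEq V]

/-- The probability of the edge set `E` when every unordered pair `e` (of possibly equal
vertices) is an edge with probability `w e`, independently. -/
def graphProb (w : Sym2 V → ℝ) (E : Finset (Sym2 V)) : ℝ :=
  ∏ e, if e ∈ E then w e else 1 - w e

lemma sum_graphProb (w : Sym2 V → ℝ) : ∑ E, graphProb w E = 1 := by
  have h := Finset.prod_add w (fun e => 1 - w e) Finset.univ
  simp only [add_sub_cancel, Finset.prod_const_one, Finset.powerset_univ] at h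
  rw [h]
  refine Finset.sum_congr rfl fun E _ => ?_
  unfold graphProb
  rw [Finset.prod_ite]
  congr 1
  · congr 1
    ext; simp
  · congr 1
    ext; simp

/-- The expected load of the allocation `A` on a random graph with independent edges. -/
def avgLoad {K : ℕ} (w : Sym2 V → ℝ) (A : Allocation V K) (T : ℕ) : ℝ :=
  ∑ E, graphProb w E * load E A T

/-- The minimum average normalized communication load `L*(r)` of a random graph. -/
def optLoad (w : Sym2 V → ℝ) (K r T : ℕ) (equal : Prop) : ℝ :=
  sInf ((fun A => avgLoad w A T) '' allocations V K r equal)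

end RandomGraph

/-- The edge probabilities of the stochastic block model `SBM(n₁, n₂, p, q)`: the clusters are
the two summands of the vertex set `Fin n₁ ⊕ Fin n₂`; two (possibly equal) vertices of the same
cluster are joined with probability `p`, vertices of different clusters with probability `q`. -/
def sbmProb (n₁ n₂ : ℕ) (p q : ℝ) : Sym2 (Fin n₁ ⊕ Fin n₂) → ℝ :=
  Sym2.lift ⟨fun a b => if a.isLeft = b.isLeft then p else q, fun a b => by
    simp only [eq_comm]⟩

/-- `L*(r)` for `SBM(n₁, n₂, p, q)`, `K` machines and intermediate values of `T` bits. -/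
def sbmOptLoad (n₁ n₂ : ℕ) (p q : ℝ) (K r T : ℕ) (equal : Prop) : ℝ :=
  optLoad (sbmProb n₁ n₂ p q) K r T equal

/-- The limit `n → ∞` along the `n` divisible by `K`, for which sets of size `n / K` exist. -/
def atTopDvd (K : ℕ) : Filter ℕ := atTop ⊓ 𝓟 {n | K ∣ n}

end GraphMapReduce

end

/-!
*Lower bound.* Fix a graph, an allocation and a scheme. Given everything that the machines outside
a set `S` have to know, the messages of `S` still take at least `2 ^ (T * demand S)` values, where
a value needed in `S` and Mapped at `b` machines, all of them in `S`, counts `1 / b`. This goes by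
induction on `S`: for every `k ∈ S`, each message of `k` leaves open all values that are fresh
for `k`, by decodability these lead to different messages of the other machines, and for each of
them the induction hypothesis applies to `S \ {k}`; averaging over `k ∈ S` gives the exponent. For
the set of all machines, the expectation over the graph is at least `q` times a sum of
`(K - b) / b` over the vertices, up to a factor, and this function of `b` is convex with average
argument `r`.

*Upper bound.* Let every vertex be Mapped by exactly `r` machines. In each group of `r + 1`
machines, a packet of bits needed by one member is known to the others, so the exclusive or of `r`
packets serves `r` machines at once. If the set of Mappers runs through the cyclic shifts of all
`r`-element sets along the vertices of each cluster, every pair of a group and a member expects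
the same share `D / (K * choose K r)` of the expected number `D` of ordered pairs, up to `O(p n)`.
The edges are independent, so the deviations from these expectations are `O(√D)` in mean, and both
errors are negligible because `D ≥ p n² / 2 → ∞`.
-/

noncomputable section

namespace GraphMapReduce

section Mean

variable {V : Type*} [Fintype V] [DecidableEq V] {w : Sym2 V → ℝ}

/-- The expectation of `f 𝒢` for the random graph `𝒢` with independent edges of probabilities
`w`. -/
def mean (w : Sym2 V → ℝ) (f : Finset (Sym2 V) → ℝ) : ℝ :=
  ∑ E, graphProb w E * f E

lemma graphProb_nonneg (h0 : ∀ e, 0 ≤ w e) (h1 : ∀ e, w e ≤ 1) (E : Finset (Sym2 V)) :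
    0 ≤ graphProb w E :=
  Finset.prod_nonneg fun e _ => by
    split_ifs
    exacts [h0 e, sub_nonneg.2 (h1 e)]

lemma mean_mono (h0 : ∀ e, 0 ≤ w e) (h1 : ∀ e, w e ≤ 1) {f g : Finset (Sym2 V) → ℝ}
    (hfg : ∀ E, f E ≤ g E) : mean w f ≤ mean w g :=
  Finset.sum_le_sum fun E _ => mul_le_mul_of_nonneg_left (hfg E) (graphProb_nonneg h0 h1 E)

lemma mean_const (w : Sym2 V → ℝ) (c : ℝ) : (mean w fun _ => c) = c := by
  rw [mean, ← Finset.sum_mul, sum_graphProb, one_mul]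

lemma mean_add (w : Sym2 V → ℝ) (f g : Finset (Sym2 V) → ℝ) :
    (mean w fun E => f E + g E) = mean w f + mean w g := by
  simp only [mean, mul_add, Finset.sum_add_distrib]

lemma mean_const_mul (w : Sym2 V → ℝ) (c : ℝ) (f : Finset (Sym2 V) → ℝ) :
    (mean w fun E => c * f E) = c * mean w f := by
  simp only [mean, Finset.mul_sum, mul_left_comm]

lemma mean_sum {ι : Type*} (w : Sym2 V → ℝ) (s : Finset ι) (f : ι → Finset (Sym2 V) → ℝ) :
    (mean w fun E => ∑ i ∈ s, f i E) = ∑ i ∈ s, mean w (f i) := by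
  simp only [mean, Finset.mul_sum]
  exact Finset.sum_comm

lemma mean_abs_le_sqrt_mean_sq (h0 : ∀ e, 0 ≤ w e) (h1 : ∀ e, w e ≤ 1)
    (f : Finset (Sym2 V) → ℝ) :
    (mean w fun E => |f E|) ≤ √(mean w fun E => f E ^ 2) := by
  have hP := graphProb_nonneg h0 h1
  refine Real.le_sqrt_of_sq_le ?_
  calc (mean w fun E => |f E|) ^ 2
      ≤ (∑ E, graphProb w E) * mean w fun E => f E ^ 2 :=
        Finset.sum_sq_le_sum_mul_sum_of_sq_le_mul _ (fun E _ => hP E)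
          (fun E _ => mul_nonneg (hP E) (sq_nonneg _)) fun E _ => by
            rw [mul_pow, sq_abs, sq, mul_assoc]
    _ = mean w fun E => f E ^ 2 := by rw [sum_graphProb, one_mul]

lemma graphProb_eq_prod_mul_prod (w : Sym2 V → ℝ) (E : Finset (Sym2 V)) :
    graphProb w E = (∏ e ∈ E, w e) * ∏ e ∈ Finset.univ \ E, (1 - w e) := by
  rw [graphProb, Finset.prod_ite, Finset.filter_univ_mem, Finset.filter_notMem_eq_sdiff]

lemma mean_indicator_superset (w : Sym2 V → ℝ) (F : Finset (Sym2 V)) :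
    (mean w fun E => if F ⊆ E then 1 else 0) = ∏ e ∈ F, w e := by
  have hterm : ∀ E : Finset (Sym2 V), graphProb w E * (if F ⊆ E then 1 else 0)
      = (∏ e ∈ E, w e) * ∏ e ∈ Finset.univ \ E, if e ∈ F then 0 else 1 - w e := by
    intro E
    rw [graphProb_eq_prod_mul_prod, mul_assoc]
    congr 1
    split_ifs with hF
    · rw [mul_one]
      refine Finset.prod_congr rfl fun e he => (if_neg fun heF => ?_).symm
      exact (Finset.mem_sdiff.1 he).2 (hF heF)
    · obtain ⟨e, heF, heE⟩ := Finset.not_subset.1 hF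
      have he : e ∈ Finset.univ \ E := Finset.mem_sdiff.2 ⟨Finset.mem_univ e, heE⟩
      rw [mul_zero, eq_comm]
      exact Finset.prod_eq_zero he (if_pos heF)
  calc (mean w fun E => if F ⊆ E then 1 else 0)
      = ∏ e, (w e + if e ∈ F then 0 else 1 - w e) := by
        rw [Finset.prod_add, Finset.powerset_univ]
        exact Finset.sum_congr rfl fun E _ => hterm E
    _ = ∏ e, if e ∈ F then w e else 1 :=
        Finset.prod_congr rfl fun e _ => by split_ifs <;> ring
    _ = ∏ e ∈ F, w e := by rw [Finset.prod_ite_mem, Finset.univ_inter]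

lemma mean_indicator_mem (w : Sym2 V → ℝ) (e : Sym2 V) :
    (mean w fun E => if e ∈ E then 1 else 0) = w e := by
  simpa using mean_indicator_superset w {e}

lemma mean_indicator_mem_mul (w : Sym2 V → ℝ) (e f : Sym2 V) :
    (mean w fun E => (if e ∈ E then 1 else 0) * if f ∈ E then 1 else 0)
      = if e = f then w e else w e * w f := by
  have hpair : ∀ E : Finset (Sym2 V), (if e ∈ E then (1 : ℝ) else 0) * (if f ∈ E then 1 else 0)
      = if {e, f} ⊆ E then 1 else 0 := fun E => by
    simp only [Finset.insert_subset_iff, Finset.singleton_subset_iff, ite_zero_mul_ite_zero,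
      mul_one]
  simp only [hpair, mean_indicator_superset]
  split_ifs with hef
  · simp [hef]
  · exact Finset.prod_pair hef

lemma mean_centered_mul_centered (w : Sym2 V → ℝ) (e f : Sym2 V) :
    (mean w fun E => ((if e ∈ E then 1 else 0) - w e) * ((if f ∈ E then 1 else 0) - w f))
      = if e = f then w e * (1 - w e) else 0 := by
  have hexpand : ∀ E : Finset (Sym2 V),
      ((if e ∈ E then (1 : ℝ) else 0) - w e) * ((if f ∈ E then 1 else 0) - w f)
        = (if e ∈ E then 1 else 0) * (if f ∈ E then 1 else 0)
          + (-w f * (if e ∈ E then 1 else 0) + (-w e * (if f ∈ E then 1 else 0) + w e * w f)) :=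
    fun E => by ring
  simp only [hexpand, mean_add, mean_const_mul, mean_const, mean_indicator_mem,
    mean_indicator_mem_mul]
  split_ifs with hef
  · rw [hef]
    ring
  · ring

/-- The number of the ordered pairs in `P` that are edges of `E`. A non-diagonal edge counts
twice if `P` contains both of its orientations. -/
def edgeCount (P : Finset (V × V)) (E : Finset (Sym2 V)) : ℕ :=
  (P.filter fun x => s(x.1, x.2) ∈ E).card

lemma mean_sum_filter_edge (w : Sym2 V → ℝ) (c : V × V → ℝ) :
    (mean w fun E => ∑ x with s(x.1, x.2) ∈ E, c x) = ∑ x, c x * w s(x.1, x.2) := by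
  have hite : ∀ E : Finset (Sym2 V), ∑ x with s(x.1, x.2) ∈ E, c x
      = ∑ x : V × V, c x * if s(x.1, x.2) ∈ E then 1 else 0 := fun E => by
    simp only [Finset.sum_filter, mul_ite, mul_one, mul_zero]
  simp only [hite, mean_sum, mean_const_mul, mean_indicator_mem]

omit [Fintype V] in
lemma card_filter_sym2_eq_le_two (P : Finset (V × V)) (e : Sym2 V) :
    (P.filter fun y => e = s(y.1, y.2)).card ≤ 2 := by
  induction e with
  | _ a b =>
    have hsub : (P.filter fun y => s(a, b) = s(y.1, y.2)) ⊆ {(a, b), (b, a)} := by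
      rintro ⟨c, d⟩ hy
      rcases Sym2.eq_iff.1 (Finset.mem_filter.1 hy).2 with ⟨rfl, rfl⟩ | ⟨rfl, rfl⟩ <;> simp
    exact (Finset.card_le_card hsub).trans Finset.card_le_two

lemma variance_edgeCount_le (h0 : ∀ e, 0 ≤ w e) (P : Finset (V × V)) :
    (mean w fun E => ((edgeCount P E : ℝ) - ∑ x ∈ P, w s(x.1, x.2)) ^ 2)
      ≤ 2 * ∑ x ∈ P, w s(x.1, x.2) := by
  have hcentered : ∀ E, (edgeCount P E : ℝ) - ∑ x ∈ P, w s(x.1, x.2)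
      = ∑ x ∈ P, ((if s(x.1, x.2) ∈ E then 1 else 0) - w s(x.1, x.2)) := fun E => by
    rw [Finset.sum_sub_distrib, Finset.sum_boole, edgeCount]
  simp only [hcentered, sq, Finset.sum_mul_sum, mean_sum, mean_centered_mul_centered]
  rw [Finset.mul_sum]
  refine Finset.sum_le_sum fun x _ => ?_
  have hw := h0 s(x.1, x.2)
  have hcard : ((P.filter fun y => s(x.1, x.2) = s(y.1, y.2)).card : ℝ) ≤ 2 := by
    exact_mod_cast card_filter_sym2_eq_le_two P s(x.1, x.2)
  rw [← Finset.sum_filter, Finset.sum_const, nsmul_eq_mul]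
  calc _ ≤ _ * w s(x.1, x.2) := by gcongr; nlinarith
    _ ≤ 2 * w s(x.1, x.2) := by gcongr

lemma mean_abs_edgeCount_sub_le (h0 : ∀ e, 0 ≤ w e) (h1 : ∀ e, w e ≤ 1) (P : Finset (V × V)) :
    (mean w fun E => |(edgeCount P E : ℝ) - ∑ x ∈ P, w s(x.1, x.2)|)
      ≤ √(2 * ∑ x ∈ P, w s(x.1, x.2)) :=
  (mean_abs_le_sqrt_mean_sq h0 h1 _).trans (Real.sqrt_le_sqrt (variance_edgeCount_le h0 P))

end Mean

section Scheme

variable {V : Type*} {K T : ℕ} {E : Finset (Sym2 V)} {A : Allocation V K}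
  {S : Finset (Fin K)} {k : Fin K}

/-- The intermediate values that machine `k` has Mapped itself. -/
def localValues (A : Allocation V K) (k : Fin K) (v : ValueIdx E → Word T) :
    LocalIdx E (A.M k) → Word T :=
  fun e => v e.1

/-- The intermediate values that machine `k` has to recover from the Shuffle messages. -/
def neededValues (A : Allocation V K) (k : Fin K) (v : ValueIdx E → Word T) :
    NeededIdx E (A.M k) (A.R k) → Word T :=
  fun e => v e.1

lemma localValues_eq_iff {v v' : ValueIdx E → Word T} :
    localValues A k v = localValues A k v' ↔ ∀ e : ValueIdx E, e.1.2 ∈ A.M k → v e = v' e :=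
  funext_iff.trans Subtype.forall

lemma exists_shuffleScheme {I : Fin K → Type*} [∀ k, Fintype (I k)]
    (enc : ∀ k, (ValueIdx E → Word T) → I k → Bool)
    (hloc : ∀ k, (enc k).FactorsThrough (localValues A k))
    (hdec : ∀ k, (neededValues A k).FactorsThrough fun v =>
      (localValues A k v, fun l : {l : Fin K // l ≠ k} => enc l v)) :
    ∃ s : ShuffleScheme E A T, ∀ k, s.len k = Fintype.card (I k) := by
  let code : ∀ k, (ValueIdx E → Word T) → Word (Fintype.card (I k)) := fun k v i =>
    enc k v ((Fintype.equivFin (I k)).symm i)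
  let received : ∀ k, (ValueIdx E → Word T) → (LocalIdx E (A.M k) → Word T) ×
      (∀ l : {l : Fin K // l ≠ k}, Word (Fintype.card (I l))) :=
    fun k v => (localValues A k v, fun l => code l v)
  have hcode : ∀ k, (code k).FactorsThrough (localValues A k) := fun k v v' h =>
    funext fun i => congrFun (hloc k h) _
  have hreceived : ∀ k, (neededValues A k).FactorsThrough (received k) := by
    intro k v v' h
    obtain ⟨hl, hm⟩ := Prod.ext_iff.1 h
    refine hdec k (Prod.ext hl (funext fun l => funext fun i => ?_))
    simpa [received, code] using congrFun (congrFun hm l) (Fintype.equivFin (I l) i)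
  refine ⟨{ len := fun k => Fintype.card (I k)
            encode := fun k => Function.extend (localValues A k) (code k) default
            decode := fun k x m => Function.extend (received k) (neededValues A k) default (x, m)
            correct := fun v k => ?_ }, fun _ => rfl⟩
  have hencode : ∀ l, Function.extend (localValues A l) (code l) default (fun e => v e.1)
      = code l v := fun l => (hcode l).extend_apply _ v
  simp only [hencode]
  exact (hreceived k).extend_apply _ v

lemma minBits_le (s : ShuffleScheme E A T) :
    minBits E A T ≤ ∑ k, s.len k :=
  Nat.sInf_le ⟨s, rfl⟩

lemma exists_minBits_eq [Finite V] (T : ℕ) (hA : ∀ v, ∃ k, v ∈ A.M k) :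
    ∃ s : ShuffleScheme E A T, minBits E A T = ∑ k, s.len k := by
  classical
  have := Fintype.ofFinite V
  -- Uncoded transmission is feasible: every machine multicasts all of its local values.
  obtain ⟨s, -⟩ := exists_shuffleScheme (A := A) (I := fun k => LocalIdx E (A.M k) × Fin T)
    (fun k v i => v i.1.1 i.2)
    (fun k v v' h => funext fun i => congrFun (congrFun h i.1) i.2)
    (fun k v v' h => by
      funext e t
      obtain ⟨l, hl⟩ := hA e.1.1.2
      have hlk : l ≠ k := fun hlk => e.2.2 (hlk ▸ hl)
      exact congrFun (congrFun (congrArg Prod.snd h) ⟨l, hlk⟩) (⟨e.1, hl⟩, t))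
  exact Nat.sInf_mem (s := {b | ∃ s : ShuffleScheme E A T, b = ∑ k, s.len k}) ⟨_, s, rfl⟩

/-- The configurations `v` and `v'` agree on all values that are local to, or needed by, a
machine outside `S`. -/
def AgreeOutside (A : Allocation V K) (S : Finset (Fin K)) (v v' : ValueIdx E → Word T) : Prop :=
  ∀ e : ValueIdx E, ∀ k ∉ S, e.1.1 ∈ A.R k ∨ e.1.2 ∈ A.M k → v e = v' e

lemma AgreeOutside.trans {v v' v'' : ValueIdx E → Word T} (h : AgreeOutside A S v v')
    (h' : AgreeOutside A S v' v'') : AgreeOutside A S v v'' :=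
  fun e k hk hek => (h e k hk hek).trans (h' e k hk hek)

lemma AgreeOutside.mono {S' : Finset (Fin K)} {v v' : ValueIdx E → Word T}
    (h : AgreeOutside A S v v') (hS : S ⊆ S') : AgreeOutside A S' v v' :=
  fun e k hk => h e k fun hkS => hk (hS hkS)

lemma AgreeOutside.localValues_eq {v v' : ValueIdx E → Word T} (h : AgreeOutside A S v v')
    (hk : k ∉ S) : localValues A k v = localValues A k v' :=
  funext fun e => h e.1 k hk (Or.inr e.2)

/-- The messages that the machines multicast in the scheme `s` if the intermediate values
are `v`. -/
def messages (s : ShuffleScheme E A T) (v : ValueIdx E → Word T) : ∀ k, Word (s.len k) :=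
  fun k => s.encode k (localValues A k v)

lemma neededValues_eq_of_messages_eq (s : ShuffleScheme E A T) {v v' : ValueIdx E → Word T}
    (hloc : localValues A k v = localValues A k v') (hmsg : messages s v = messages s v') :
    neededValues A k v = neededValues A k v' := by
  have hdecode : ∀ v, s.decode k (localValues A k v) (fun l => messages s v l)
      = neededValues A k v := fun v => s.correct v k
  rw [← hdecode v, ← hdecode v', hloc, hmsg]

end Scheme

section Converse

variable {V : Type*} [DecidableEq V] {K T : ℕ} {A : Allocation V K}

/-- The machines that Map the vertex `j`. -/
def mappers (A : Allocation V K) (j : V) : Finset (Fin K) :=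
  Finset.univ.filter fun k => j ∈ A.M k

lemma mem_mappers {j : V} {k : Fin K} : k ∈ mappers A j ↔ j ∈ A.M k := by
  simp [mappers]

lemma card_mappers_pos (hM : ∀ v, ∃ k, v ∈ A.M k) (j : V) : 0 < (mappers A j).card := by
  obtain ⟨k, hk⟩ := hM j
  exact Finset.card_pos.2 ⟨k, mem_mappers.2 hk⟩

/-- The contribution of the ordered pair `x` to the demand of all machines, if `x` is an edge. -/
def demandWeight (A : Allocation V K) (x : V × V) : ℝ :=
  ∑ k with x.1 ∈ A.R k ∧ x.2 ∉ A.M k, 1 / ((mappers A x.2).card : ℝ)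

lemma demandWeight_nonneg (A : Allocation V K) (x : V × V) : 0 ≤ demandWeight A x :=
  Finset.sum_nonneg fun _ _ => by positivity

variable [Fintype V] {E : Finset (Sym2 V)} {S : Finset (Fin K)} {k : Fin K}

/-- The values needed by the machine `k` that are Mapped only at machines of `S` other
than `k`. -/
def fresh (E : Finset (Sym2 V)) (A : Allocation V K) (S : Finset (Fin K)) (k : Fin K) :
    Finset (ValueIdx E) :=
  Finset.univ.filter fun e => e.1.1 ∈ A.R k ∧ mappers A e.1.2 ⊆ S.erase k

lemma mem_fresh {e : ValueIdx E} :
    e ∈ fresh E A S k ↔ e.1.1 ∈ A.R k ∧ mappers A e.1.2 ⊆ S.erase k := by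
  simp [fresh]

lemma notMem_of_mem_fresh {e : ValueIdx E} (he : e ∈ fresh E A S k) : e.1.2 ∉ A.M k := fun h =>
  Finset.notMem_erase k S ((mem_fresh.1 he).2 (mem_mappers.2 h))

lemma fresh_erase (E : Finset (Sym2 V)) (A : Allocation V K) (S : Finset (Fin K)) (k l : Fin K) :
    fresh E A (S.erase k) l = (fresh E A S l).filter fun e => k ∉ mappers A e.1.2 := by
  ext e
  simp only [Finset.mem_filter, mem_fresh, Finset.erase_right_comm (a := k), Finset.subset_erase,
    and_assoc]

/-- A lower bound, in words of `T` bits, for what the machines in `S` have to tell each other even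
if they share the knowledge of all other machines: a value that is needed by one of them and
Mapped only at `b` of them counts `1 / b`. -/
def demand (E : Finset (Sym2 V)) (A : Allocation V K) (S : Finset (Fin K)) : ℝ :=
  ∑ k ∈ S, ∑ e ∈ fresh E A S k, 1 / ((mappers A e.1.2).card : ℝ)

lemma sum_demand_erase (E : Finset (Sym2 V)) (A : Allocation V K) (S : Finset (Fin K)) :
    ∑ k ∈ S, demand E A (S.erase k) = ∑ l ∈ S, ∑ e ∈ fresh E A S l,
      ((S.erase l \ mappers A e.1.2).card : ℝ) / (mappers A e.1.2).card := by
  simp only [demand]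
  rw [Finset.sum_comm' (t' := S) (s' := fun l => S.erase l)
    (by simp only [Finset.mem_erase]; tauto)]
  refine Finset.sum_congr rfl fun l _ => ?_
  simp only [fresh_erase, Finset.sum_filter]
  rw [Finset.sum_comm]
  refine Finset.sum_congr rfl fun e _ => ?_
  rw [← Finset.sum_filter, Finset.filter_notMem_eq_sdiff, Finset.sum_const, nsmul_eq_mul,
    mul_one_div]

lemma card_sub_one_mul_demand (hM : ∀ v, ∃ k, v ∈ A.M k) (E : Finset (Sym2 V))
    (S : Finset (Fin K)) :
    ((S.card : ℝ) - 1) * demand E A S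
      = ∑ k ∈ S, (((fresh E A S k).card : ℝ) + demand E A (S.erase k)) := by
  rw [Finset.sum_add_distrib, sum_demand_erase, ← Finset.sum_add_distrib, demand, Finset.mul_sum]
  refine Finset.sum_congr rfl fun l hl => ?_
  rw [Finset.card_eq_sum_ones (fresh E A S l), Nat.cast_sum, ← Finset.sum_add_distrib,
    Finset.mul_sum]
  refine Finset.sum_congr rfl fun e he => ?_
  have hpos : ((mappers A e.1.2).card : ℝ) ≠ 0 := by exact_mod_cast (card_mappers_pos hM _).ne'
  rw [Finset.cast_card_sdiff (mem_fresh.1 he).2, Finset.cast_card_erase_of_mem hl]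
  field_simp
  push_cast
  ring

lemma localValues_updateFinset_fresh (v : ValueIdx E → Word T) (z : fresh E A S k → Word T) :
    localValues A k (Function.updateFinset v (fresh E A S k) z) = localValues A k v :=
  funext fun e => dif_neg fun he => notMem_of_mem_fresh he e.2

lemma agreeOutside_updateFinset_fresh (hR : ∀ k l, k ≠ l → Disjoint (A.R k) (A.R l)) (hk : k ∈ S)
    (v : ValueIdx E → Word T) (z : fresh E A S k → Word T) :
    AgreeOutside A S (Function.updateFinset v (fresh E A S k) z) v := by
  intro e l hl hel
  refine dif_neg fun he => ?_
  obtain ⟨heR, heM⟩ := mem_fresh.1 he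
  rcases hel with helR | helM
  · exact Finset.disjoint_left.1 (hR k l fun hkl => hl (hkl ▸ hk)) heR helR
  · exact hl (Finset.mem_of_mem_erase (heM (mem_mappers.2 helM)))

open Classical in
/-- The messages that the machines may multicast, given what the machines outside `S` know of
the intermediate values `v₀`. -/
def reachable (s : ShuffleScheme E A T) (S : Finset (Fin K)) (v₀ : ValueIdx E → Word T) :
    Finset (∀ k, Word (s.len k)) :=
  (Finset.univ.filter fun v => AgreeOutside A S v v₀).image (messages s)

lemma mem_reachable {s : ShuffleScheme E A T} {v₀ : ValueIdx E → Word T}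
    {x : ∀ k, Word (s.len k)} :
    x ∈ reachable s S v₀ ↔ ∃ v, AgreeOutside A S v v₀ ∧ messages s v = x := by
  simp [reachable]

lemma card_reachable_pos (s : ShuffleScheme E A T) (S : Finset (Fin K))
    (v₀ : ValueIdx E → Word T) : 0 < (reachable s S v₀).card :=
  Finset.card_pos.2 ⟨messages s v₀, mem_reachable.2 ⟨v₀, fun _ _ _ _ => rfl, rfl⟩⟩

lemma reachable_updateFinset_subset (s : ShuffleScheme E A T)
    (hR : ∀ k l, k ≠ l → Disjoint (A.R k) (A.R l)) (hk : k ∈ S) {v₀ v₁ : ValueIdx E → Word T}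
    (h : AgreeOutside A S v₁ v₀) (z : fresh E A S k → Word T) :
    reachable s (S.erase k) (Function.updateFinset v₁ (fresh E A S k) z)
      ⊆ (reachable s S v₀).filter fun x => x k = messages s v₁ k := by
  intro x hx
  obtain ⟨v, hv, rfl⟩ := mem_reachable.1 hx
  have hlocal : localValues A k v = localValues A k v₁ :=
    (hv.localValues_eq (Finset.notMem_erase k S)).trans (localValues_updateFinset_fresh v₁ z)
  refine Finset.mem_filter.2 ⟨mem_reachable.2 ⟨v, ?_, rfl⟩, congrArg (s.encode k) hlocal⟩
  exact ((hv.mono (Finset.erase_subset k S)).trans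
    (agreeOutside_updateFinset_fresh hR hk v₁ z)).trans h

lemma disjoint_reachable_updateFinset (s : ShuffleScheme E A T) (v₁ : ValueIdx E → Word T)
    {z z' : fresh E A S k → Word T} (hz : z ≠ z') :
    Disjoint (reachable s (S.erase k) (Function.updateFinset v₁ (fresh E A S k) z))
      (reachable s (S.erase k) (Function.updateFinset v₁ (fresh E A S k) z')) := by
  refine Finset.disjoint_left.2 fun x hx hx' => hz (funext fun e => ?_)
  obtain ⟨v, hv, rfl⟩ := mem_reachable.1 hx
  obtain ⟨v', hv', hmsg⟩ := mem_reachable.1 hx'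
  have hkS := Finset.notMem_erase k S
  have hlocal : localValues A k v = localValues A k v' := by
    rw [hv.localValues_eq hkS, hv'.localValues_eq hkS, localValues_updateFinset_fresh,
      localValues_updateFinset_fresh]
  have heR := (mem_fresh.1 e.2).1
  have hve : v e = v' e := congrFun (neededValues_eq_of_messages_eq s hlocal hmsg.symm)
    ⟨e, heR, notMem_of_mem_fresh e.2⟩
  rw [hv e k hkS (Or.inl heR), hv' e k hkS (Or.inl heR)] at hve
  simpa [Function.updateFinset] using hve

lemma pow_card_fresh_mul_le_card_fiber (s : ShuffleScheme E A T)
    (hR : ∀ k l, k ≠ l → Disjoint (A.R k) (A.R l)) (hk : k ∈ S) {v₀ v₁ : ValueIdx E → Word T}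
    (h : AgreeOutside A S v₁ v₀) {b : ℝ} (hb : ∀ v, b ≤ (reachable s (S.erase k) v).card) :
    ((2 : ℝ) ^ T) ^ (fresh E A S k).card * b
      ≤ ((reachable s S v₀).filter fun x => x k = messages s v₁ k).card := by
  let extend := fun z : fresh E A S k → Word T => Function.updateFinset v₁ (fresh E A S k) z
  calc ((2 : ℝ) ^ T) ^ (fresh E A S k).card * b
      = ∑ _z : fresh E A S k → Word T, b := by simp [Word]
    _ ≤ ∑ z, ((reachable s (S.erase k) (extend z)).card : ℝ) :=
        Finset.sum_le_sum fun z _ => hb (extend z)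
    _ = (Finset.univ.biUnion fun z => reachable s (S.erase k) (extend z)).card := by
        rw [Finset.card_biUnion fun z _ z' _ hz => disjoint_reachable_updateFinset s v₁ hz,
          Nat.cast_sum]
    _ ≤ _ := by
        gcongr
        exact Finset.biUnion_subset.2 fun z _ => reachable_updateFinset_subset s hR hk h z

lemma card_image_mul_le_card_reachable (s : ShuffleScheme E A T)
    (hR : ∀ k l, k ≠ l → Disjoint (A.R k) (A.R l)) (hk : k ∈ S) (v₀ : ValueIdx E → Word T)
    {b : ℝ} (hb : ∀ v, b ≤ (reachable s (S.erase k) v).card) :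
    (((reachable s S v₀).image fun x => x k).card : ℝ)
      * (((2 : ℝ) ^ T) ^ (fresh E A S k).card * b) ≤ (reachable s S v₀).card := by
  rw [Finset.card_eq_sum_card_image (fun x => x k) (reachable s S v₀), ← nsmul_eq_mul,
    Nat.cast_sum]
  refine Finset.card_nsmul_le_sum _ _ _ fun y hy => ?_
  obtain ⟨x, hx, rfl⟩ := Finset.mem_image.1 hy
  obtain ⟨v, hv, rfl⟩ := mem_reachable.1 hx
  exact pow_card_fresh_mul_le_card_fiber s hR hk hv hb

lemma logb_card_reachable_le_sum (s : ShuffleScheme E A T) (S : Finset (Fin K))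
    (v₀ : ValueIdx E → Word T) :
    Real.logb 2 (reachable s S v₀).card
      ≤ ∑ k ∈ S, Real.logb 2 ((reachable s S v₀).image fun x => x k).card := by
  have hpos := card_reachable_pos s S v₀
  have hprod : (reachable s S v₀).card
      ≤ ∏ k, ((reachable s S v₀).image fun x => x k).card := by
    rw [← Fintype.card_piFinset]
    exact Finset.card_le_card fun x hx =>
      Fintype.mem_piFinset.2 fun k => Finset.mem_image_of_mem _ hx
  have hne : ∀ k, ((reachable s S v₀).image fun x => x k).card ≠ 0 := fun k =>
    (Finset.card_pos.2 ((Finset.card_pos.1 hpos).image _)).ne'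
  have hconst : ∀ k ∉ S, ((reachable s S v₀).image fun x => x k).card = 1 := by
    intro k hk
    refine le_antisymm ((Finset.card_le_card (t := {messages s v₀ k}) ?_).trans_eq
      (Finset.card_singleton _)) (Nat.one_le_iff_ne_zero.2 (hne k))
    refine Finset.image_subset_iff.2 fun x hx => ?_
    obtain ⟨v, hv, rfl⟩ := mem_reachable.1 hx
    exact Finset.mem_singleton.2 (congrArg (s.encode k) (hv.localValues_eq hk))
  rw [← Finset.prod_subset (Finset.subset_univ S) fun k _ hk => hconst k hk] at hprod
  rw [← Real.logb_prod _ _ fun k _ => Nat.cast_ne_zero.2 (hne k)]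
  exact Real.logb_le_logb_of_le one_lt_two (by exact_mod_cast hpos) (by exact_mod_cast hprod)

lemma logb_card_image_add_le (s : ShuffleScheme E A T)
    (hR : ∀ k l, k ≠ l → Disjoint (A.R k) (A.R l)) (hk : k ∈ S) (v₀ : ValueIdx E → Word T)
    {d : ℝ} (hd : ∀ v, T * d ≤ Real.logb 2 (reachable s (S.erase k) v).card) :
    Real.logb 2 ((reachable s S v₀).image fun x => x k).card + T * ((fresh E A S k).card + d)
      ≤ Real.logb 2 (reachable s S v₀).card := by
  have hb : ∀ v, (2 : ℝ) ^ (T * d) ≤ (reachable s (S.erase k) v).card := fun v =>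
    (Real.le_logb_iff_rpow_le one_lt_two (by exact_mod_cast card_reachable_pos s _ v)).1 (hd v)
  have himage : (0 : ℝ) < ((reachable s S v₀).image fun x => x k).card := by
    exact_mod_cast Finset.card_pos.2 ((Finset.card_pos.1 (card_reachable_pos s S v₀)).image _)
  have hwords : ((2 : ℝ) ^ T) ^ (fresh E A S k).card * (2 : ℝ) ^ (T * d)
      = 2 ^ (T * ((fresh E A S k).card + d)) := by
    rw [← pow_mul, ← Real.rpow_natCast, ← Real.rpow_add two_pos, Nat.cast_mul, mul_add]
  have h := Real.logb_le_logb_of_le one_lt_two (by positivity)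
    (card_image_mul_le_card_reachable s hR hk v₀ hb)
  rwa [hwords, Real.logb_mul himage.ne' (by positivity),
    Real.logb_rpow two_pos (by norm_num)] at h

lemma demand_eq_zero_of_card_le_one (hM : ∀ v, ∃ k, v ∈ A.M k) (E : Finset (Sym2 V))
    (hS : S.card ≤ 1) : demand E A S = 0 := by
  refine Finset.sum_eq_zero fun k hk => Finset.sum_eq_zero fun e he => ?_
  obtain ⟨l, hl⟩ := Finset.card_pos.1 (card_mappers_pos hM e.1.2)
  obtain ⟨hlk, hlS⟩ := Finset.mem_erase.1 ((mem_fresh.1 he).2 hl)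
  exact absurd (Finset.card_le_one.1 hS l hlS k hk) hlk

lemma mul_demand_le_logb_card_reachable (s : ShuffleScheme E A T) (hM : ∀ v, ∃ k, v ∈ A.M k)
    (hR : ∀ k l, k ≠ l → Disjoint (A.R k) (A.R l)) (S : Finset (Fin K)) :
    ∀ v₀, T * demand E A S ≤ Real.logb 2 (reachable s S v₀).card := by
  induction S using Finset.strongInduction with
  | H S ih =>
    intro v₀
    rcases le_or_gt S.card 1 with hS | hS
    · rw [demand_eq_zero_of_card_le_one hM E hS, mul_zero]
      exact Real.logb_nonneg one_lt_two (by exact_mod_cast card_reachable_pos s S v₀)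
    · have hsum := Finset.sum_le_sum fun k hk =>
        logb_card_image_add_le s hR hk v₀ (ih _ (Finset.erase_ssubset hk))
      rw [Finset.sum_add_distrib, ← Finset.mul_sum, ← card_sub_one_mul_demand hM,
        Finset.sum_const, nsmul_eq_mul] at hsum
      have hsub := logb_card_reachable_le_sum s S v₀
      have hS' : (0 : ℝ) < S.card - 1 := sub_pos.2 (by exact_mod_cast hS)
      exact le_of_mul_le_mul_left (by linarith) hS'

lemma mul_demand_univ_le_minBits (E : Finset (Sym2 V)) (T : ℕ) (hM : ∀ v, ∃ k, v ∈ A.M k)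
    (hR : ∀ k l, k ≠ l → Disjoint (A.R k) (A.R l)) :
    T * demand E A Finset.univ ≤ minBits E A T := by
  obtain ⟨s, hs⟩ := exists_minBits_eq (E := E) T hM
  have hcard : (reachable s Finset.univ default).card ≤ 2 ^ ∑ k, s.len k :=
    (Finset.card_le_univ _).trans_eq (by simp [Word, Finset.prod_pow_eq_pow_sum])
  refine (mul_demand_le_logb_card_reachable s hM hR Finset.univ default).trans ?_
  rw [hs, Real.logb_le_iff_le_rpow one_lt_two (by exact_mod_cast card_reachable_pos s _ _),
    Real.rpow_natCast]
  exact_mod_cast hcard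

lemma demand_univ (E : Finset (Sym2 V)) (A : Allocation V K) :
    demand E A Finset.univ = ∑ x with s(x.1, x.2) ∈ E, demandWeight A x := by
  have hedge : ∀ x : V × V,
      x ∈ Finset.univ.filter (fun x : V × V => s(x.1, x.2) ∈ E) ↔ s(x.1, x.2) ∈ E := by simp
  rw [Finset.sum_subtype (F := inferInstance) _ hedge]
  simp only [demand, demandWeight, fresh, Finset.sum_filter, Finset.subset_erase,
    Finset.subset_univ, true_and, mem_mappers]
  exact Finset.sum_comm

lemma sum_card_mappers (A : Allocation V K) :
    ∑ j, (mappers A j).card = ∑ k, (A.M k).card := by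
  simp only [mappers, Finset.card_filter]
  rw [Finset.sum_comm]
  simp only [Finset.sum_boole, Finset.filter_univ_mem, Nat.cast_id]

lemma sum_demandWeight {c : ℝ} (hR : ∀ k, ((A.R k).card : ℝ) = c) :
    ∑ x, demandWeight A x = ∑ j, c * ((K - (mappers A j).card) / (mappers A j).card) := by
  rw [Fintype.sum_prod_type_right]
  refine Finset.sum_congr rfl fun j _ => ?_
  have hk : ∀ k, (∑ i, if i ∈ A.R k ∧ j ∉ A.M k then 1 / ((mappers A j).card : ℝ) else 0)
      = if k ∈ (mappers A j)ᶜ then c * (1 / (mappers A j).card) else 0 := fun k => by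
    by_cases hj : j ∈ A.M k <;> simp [hj, mem_mappers, hR]
  simp only [demandWeight, Finset.sum_filter]
  rw [Finset.sum_comm]
  simp only [hk]
  rw [Finset.sum_ite_mem, Finset.univ_inter, Finset.sum_const, nsmul_eq_mul, Finset.card_compl,
    Nat.cast_sub (Finset.card_le_univ _), Fintype.card_fin]
  ring

lemma mul_le_sum_sub_div {ι : Type*} [Fintype ι] {b : ι → ℝ} (hb : ∀ i, 0 < b i) {r K : ℝ}
    (hr : 0 < r) (hK : 0 ≤ K) (hsum : ∑ i, b i = r * Fintype.card ι) :
    Fintype.card ι * (K / r - 1) ≤ ∑ i, (K - b i) / b i := by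
  -- The tangent of the convex function `x ↦ (K - x) / x` at the average `r`.
  have htangent : ∀ i, K / r - 1 - K / r ^ 2 * (b i - r) ≤ (K - b i) / b i := fun i => by
    have hi := hb i
    have hgap : (K - b i) / b i - (K / r - 1 - K / r ^ 2 * (b i - r))
        = K * (b i - r) ^ 2 / (b i * r ^ 2) := by
      field_simp
      ring
    have hgap0 : 0 ≤ K * (b i - r) ^ 2 / (b i * r ^ 2) := by positivity
    linarith
  calc Fintype.card ι * (K / r - 1)
      = ∑ i, (K / r - 1 - K / r ^ 2 * (b i - r)) := by
        rw [Finset.sum_sub_distrib, ← Finset.mul_sum, Finset.sum_sub_distrib,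
          Finset.sum_sub_distrib, hsum]
        simp only [Finset.sum_const, Finset.card_univ, nsmul_eq_mul]
        ring
    _ ≤ ∑ i, (K - b i) / b i := Finset.sum_le_sum fun i _ => htangent i

lemma le_sum_demandWeight [NeZero K] {r : ℕ} (hr : 0 < r) {equal : Prop}
    (hA : A ∈ allocations V K r equal) :
    (Fintype.card V : ℝ) ^ 2 * (1 / r * (1 - r / K)) ≤ ∑ x, demandWeight A x := by
  obtain ⟨hM, hMsum, -, -, hRcard, -⟩ := hA
  have hK : (0 : ℝ) < K := Nat.cast_pos.2 (Nat.pos_of_ne_zero (NeZero.ne K))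
  have hr' : (0 : ℝ) < r := Nat.cast_pos.2 hr
  have hR : ∀ k, ((A.R k).card : ℝ) = Fintype.card V / K := fun k => by
    rw [eq_div_iff hK.ne', mul_comm]
    exact_mod_cast hRcard k
  have hb : ∀ j, (0 : ℝ) < (mappers A j).card := fun j => Nat.cast_pos.2 (card_mappers_pos hM j)
  have hbsum : ∑ j, ((mappers A j).card : ℝ) = r * Fintype.card V := by
    exact_mod_cast (sum_card_mappers A).trans hMsum
  calc (Fintype.card V : ℝ) ^ 2 * (1 / r * (1 - r / K))
      = Fintype.card V / K * (Fintype.card V * (K / r - 1)) := by field_simp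
    _ ≤ Fintype.card V / K * ∑ j, ((K - (mappers A j).card : ℝ) / (mappers A j).card) := by
        gcongr
        exact mul_le_sum_sub_div hb hr' hK.le hbsum
    _ = ∑ x, demandWeight A x := by rw [sum_demandWeight hR, Finset.mul_sum]

lemma le_avgLoad [Nonempty V] [NeZero K] {w : Sym2 V → ℝ} {q : ℝ} (hq : 0 ≤ q)
    (hqw : ∀ e, q ≤ w e) (hw : ∀ e, w e ≤ 1) {r : ℕ} (hr : 0 < r) (hT : 0 < T) {equal : Prop}
    (hA : A ∈ allocations V K r equal) :
    q * (1 / r * (1 - r / K)) ≤ avgLoad w A T := by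
  obtain ⟨hM, -, hR, -⟩ := id hA
  have : (0 : ℝ) < Fintype.card V := Nat.cast_pos.2 Fintype.card_pos
  have : (0 : ℝ) < T := Nat.cast_pos.2 hT
  have hload : ∀ E, 1 / (Fintype.card V : ℝ) ^ 2 * demand E A Finset.univ ≤ load E A T := by
    intro E
    rw [load, le_div_iff₀ (by positivity)]
    refine le_of_eq_of_le ?_ (mul_demand_univ_le_minBits E T hM hR)
    field_simp
  calc q * (1 / r * (1 - r / K))
      = 1 / (Fintype.card V : ℝ) ^ 2
          * (q * ((Fintype.card V : ℝ) ^ 2 * (1 / r * (1 - r / K)))) := by field_simp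
    _ ≤ 1 / (Fintype.card V : ℝ) ^ 2 * ∑ x : V × V, demandWeight A x * w s(x.1, x.2) := by
        gcongr
        refine (mul_le_mul_of_nonneg_left (le_sum_demandWeight hr hA) hq).trans ?_
        rw [Finset.mul_sum]
        refine Finset.sum_le_sum fun x _ => ?_
        rw [mul_comm]
        exact mul_le_mul_of_nonneg_left (hqw _) (demandWeight_nonneg A x)
    _ = mean w fun E => 1 / (Fintype.card V : ℝ) ^ 2 * demand E A Finset.univ := by
        simp only [mean_const_mul, demand_univ, mean_sum_filter_edge]
    _ ≤ avgLoad w A T := mean_mono (fun e => hq.trans (hqw e)) hw hload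

lemma le_optLoad [Nonempty V] [NeZero K] {w : Sym2 V → ℝ} {q : ℝ} (hq : 0 ≤ q)
    (hqw : ∀ e, q ≤ w e) (hw : ∀ e, w e ≤ 1) {r : ℕ} (hr : 0 < r) (hT : 0 < T) {equal : Prop}
    (hne : (allocations V K r equal).Nonempty) :
    q * (1 / r * (1 - r / K)) ≤ optLoad w K r T equal :=
  le_csInf (hne.image _) (Set.forall_mem_image.2 fun _ hA => le_avgLoad hq hqw hw hr hT hA)

lemma optLoad_le_avgLoad {w : Sym2 V → ℝ} (h0 : ∀ e, 0 ≤ w e) (h1 : ∀ e, w e ≤ 1) {r : ℕ}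
    {equal : Prop} (hA : A ∈ allocations V K r equal) :
    optLoad w K r T equal ≤ avgLoad w A T := by
  have hbdd : BddBelow ((fun A => avgLoad w A T) '' allocations V K r equal) := by
    refine ⟨0, Set.forall_mem_image.2 fun B _ => Finset.sum_nonneg fun E _ => ?_⟩
    exact mul_nonneg (graphProb_nonneg h0 h1 E) (by unfold load; positivity)
  exact csInf_le hbdd (Set.mem_image_of_mem _ hA)

end Converse

section Coding

variable {V : Type*} [Fintype V] [DecidableEq V] {K T : ℕ} {E : Finset (Sym2 V)}
  {A : Allocation V K}

/-- The ordered pairs whose values are needed by the machine `k` and known to exactly the other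
machines of the group `U`. They are served by the coded multicast within `U`. -/
def groupPairs (A : Allocation V K) (U : Finset (Fin K)) (k : Fin K) : Finset (V × V) :=
  A.R k ×ˢ Finset.univ.filter fun j => j ∉ A.M k ∧ insert k (mappers A j) = U

lemma mem_groupPairs {U : Finset (Fin K)} {k : Fin K} {x : V × V} :
    x ∈ groupPairs A U k ↔ x.1 ∈ A.R k ∧ x.2 ∉ A.M k ∧ insert k (mappers A x.2) = U := by
  simp [groupPairs]

/-- The intermediate values `v_{i,j}` of the ordered pairs `(i, j)` in `groupPairs A U k`. -/
def groupValues (E : Finset (Sym2 V)) (A : Allocation V K) (U : Finset (Fin K)) (k : Fin K) :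
    Finset (ValueIdx E) :=
  Finset.univ.filter fun e => e.1 ∈ groupPairs A U k

lemma card_groupValues (E : Finset (Sym2 V)) (A : Allocation V K) (U : Finset (Fin K))
    (k : Fin K) : (groupValues E A U k).card = edgeCount (groupPairs A U k) E := by
  rw [edgeCount, ← Finset.card_map (Function.Embedding.subtype _)]
  congr 1
  ext x
  simp [groupValues, and_comm]

lemma eq_of_localValues_eq_of_mem_groupValues {U : Finset (Fin K)} {k l : Fin K} (hl : l ∈ U)
    (hlk : l ≠ k) {v v' : ValueIdx E → Word T} (h : localValues A l v = localValues A l v') :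
    ∀ e ∈ groupValues E A U k, v e = v' e := by
  intro e he
  obtain ⟨-, -, rfl⟩ := mem_groupPairs.1 (Finset.mem_filter.1 he).2
  exact localValues_eq_iff.1 h e (mem_mappers.1 (Finset.mem_of_mem_insert_of_ne hl hlk))

/-- `packet` cuts the values indexed by `Z` into packets of `c` bits, one for each element
of `B`. -/
structure IsPacketization {ι β : Type*} (Z : Finset ι) (B : Finset β) {T c : ℕ}
    (packet : (ι → Word T) → β → Fin c → Bool) : Prop where
  congr : ∀ {v v'}, (∀ e ∈ Z, v e = v' e) → packet v = packet v'
  exists_bit : ∀ e ∈ Z, ∀ t, ∃ b ∈ B, ∃ i, ∀ v, packet v b i = v e t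

lemma exists_isPacketization {ι β : Type*} (Z : Finset ι) (B : Finset β) {T c : ℕ}
    (h : Z.card * T ≤ B.card * c) :
    ∃ packet : (ι → Word T) → β → Fin c → Bool, IsPacketization Z B packet := by
  obtain ⟨f⟩ : Nonempty (Z × Fin T ↪ B × Fin c) :=
    Function.Embedding.nonempty_of_card_le (by simpa using h)
  let position : Z × Fin T ↪ β × Fin c :=
    f.trans ((Function.Embedding.subtype _).prodMap (.refl _))
  refine ⟨fun v b i => Function.extend position (fun z => v z.1 z.2) (fun _ => false) (b, i),
    fun {v v'} hv => ?_, fun e he t => ?_⟩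
  · have hZ : (fun z : Z × Fin T => v z.1 z.2) = fun z => v' z.1 z.2 :=
      funext fun z => congrFun (hv z.1 z.1.2) z.2
    simp only [hZ]
  · exact ⟨(f (⟨e, he⟩, t)).1, (f (⟨e, he⟩, t)).1.2, (f (⟨e, he⟩, t)).2, fun v =>
      position.injective.extend_apply _ _ (⟨e, he⟩, t)⟩

/-- In every group `U` of machines that contains `l`, the machine `l` multicasts the bitwise
exclusive or of the packets with label `l` of the other machines of `U`. The packets with label
`l` are those that the machine `l` is in charge of. -/
def codedMessage {c : Finset (Fin K) → ℕ}
    (packet : ∀ U, Fin K → (ValueIdx E → Word T) → Fin K → Fin (c U) → Bool) (l : Fin K)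
    (v : ValueIdx E → Word T) (i : Σ U : {U : Finset (Fin K) // l ∈ U}, Fin (c U)) : Bool :=
  ofBoolRing (∑ k ∈ i.1.1.erase l, toBoolRing (packet i.1 k v l i.2))

variable {c : Finset (Fin K) → ℕ}
  {packet : ∀ U, Fin K → (ValueIdx E → Word T) → Fin K → Fin (c U) → Bool}

lemma codedMessage_factorsThrough
    (hpacket : ∀ U k, IsPacketization (groupValues E A U k) (U.erase k) (packet U k))
    (l : Fin K) : (codedMessage packet l).FactorsThrough (localValues A l) := by
  intro v v' h
  funext i
  refine congrArg ofBoolRing (Finset.sum_congr rfl fun k hk => ?_)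
  rw [(hpacket i.1 k).congr
    (eq_of_localValues_eq_of_mem_groupValues i.1.2 (Finset.ne_of_mem_erase hk).symm h)]

lemma packet_eq_of_codedMessage_eq
    (hpacket : ∀ U k, IsPacketization (groupValues E A U k) (U.erase k) (packet U k))
    {U : Finset (Fin K)} {k l : Fin K} (hk : k ∈ U) (hl : l ∈ U) (hlk : l ≠ k)
    {v v' : ValueIdx E → Word T} (hloc : localValues A k v = localValues A k v')
    (hmsg : codedMessage packet l v = codedMessage packet l v') :
    packet U k v l = packet U k v' l := by
  funext i
  have hsum := ofBoolRing.injective (congrFun hmsg ⟨⟨U, hl⟩, i⟩)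
  have hk' : k ∈ U.erase l := Finset.mem_erase.2 ⟨hlk.symm, hk⟩
  have hother : ∀ k' ∈ (U.erase l).erase k,
      toBoolRing (packet U k' v l i) = toBoolRing (packet U k' v' l i) := fun k' hk' => by
    rw [(hpacket U k').congr
      (eq_of_localValues_eq_of_mem_groupValues hk (Finset.ne_of_mem_erase hk').symm hloc)]
  rw [← Finset.add_sum_erase _ _ hk', ← Finset.add_sum_erase _ _ hk',
    Finset.sum_congr rfl hother] at hsum
  exact toBoolRing.injective (add_right_cancel hsum)

lemma neededValues_eq_of_codedMessage_eq
    (hpacket : ∀ U k, IsPacketization (groupValues E A U k) (U.erase k) (packet U k))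
    {k : Fin K} {v v' : ValueIdx E → Word T} (hloc : localValues A k v = localValues A k v')
    (hmsg : ∀ l ≠ k, codedMessage packet l v = codedMessage packet l v') :
    neededValues A k v = neededValues A k v' := by
  funext ⟨e, heR, heM⟩ t
  have he : e ∈ groupValues E A (insert k (mappers A e.1.2)) k :=
    Finset.mem_filter.2 ⟨Finset.mem_univ e, mem_groupPairs.2 ⟨heR, heM, rfl⟩⟩
  obtain ⟨l, hl, i, hbit⟩ := (hpacket _ k).exists_bit e he t
  obtain ⟨hlk, hlU⟩ := Finset.mem_erase.1 hl
  have h := packet_eq_of_codedMessage_eq hpacket (Finset.mem_insert_self _ _) hlU hlk hloc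
    (hmsg l hlk)
  calc v e t = packet _ k v l i := (hbit v).symm
    _ = packet _ k v' l i := congrFun h i
    _ = v' e t := hbit v'

lemma minBits_le_sum_card_mul
    (hc : ∀ U k, edgeCount (groupPairs A U k) E * T ≤ (U.erase k).card * c U) :
    minBits E A T ≤ ∑ U, U.card * c U := by
  have hexists := fun U k => exists_isPacketization (groupValues E A U k) (U.erase k)
    ((congrArg (· * T) (card_groupValues E A U k)).trans_le (hc U k))
  choose packet hpacket using hexists
  obtain ⟨s, hs⟩ := exists_shuffleScheme (codedMessage packet)
    (codedMessage_factorsThrough hpacket) fun k v v' h =>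
      neededValues_eq_of_codedMessage_eq hpacket (congrArg Prod.fst h) fun l hl =>
        congrFun (congrArg Prod.snd h) ⟨l, hl⟩
  have hlen : ∀ l, s.len l = ∑ U, if l ∈ U then c U else 0 := fun l => by
    rw [hs, Fintype.card_sigma, ← Finset.sum_filter]
    simp only [Fintype.card_fin]
    exact (Finset.sum_subtype _ (by simp) c).symm
  refine (minBits_le s).trans_eq ?_
  simp only [hlen]
  rw [Finset.sum_comm]
  simp only [Finset.sum_ite_mem, Finset.univ_inter, Finset.sum_const, smul_eq_mul]

lemma minBits_le_sum_powersetCard {r : ℕ} (hA : ∀ j, (mappers A j).card = r)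
    (hc : ∀ U k, edgeCount (groupPairs A U k) E * T ≤ r * c U) :
    minBits E A T ≤ ∑ U ∈ Finset.univ.powersetCard (r + 1), (r + 1) * c U := by
  let c' : Finset (Fin K) → ℕ := fun U => if U.card = r + 1 then c U else 0
  refine (minBits_le_sum_card_mul (c := c') fun U k => ?_).trans_eq ?_
  · rcases (groupPairs A U k).eq_empty_or_nonempty with hempty | ⟨x, hx⟩
    · simp [hempty, edgeCount]
    · obtain ⟨-, hxk, rfl⟩ := mem_groupPairs.1 hx
      have hk : k ∉ mappers A x.2 := mt mem_mappers.1 hxk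
      have hcard : (insert k (mappers A x.2)).card = r + 1 := by
        rw [Finset.card_insert_of_notMem hk, hA]
      simpa only [c', hcard, if_true, Finset.erase_insert hk, hA] using hc _ k
  · rw [Finset.powersetCard_eq_filter, Finset.powerset_univ, Finset.sum_filter]
    refine Finset.sum_congr rfl fun U _ => ?_
    simp only [c']
    split_ifs with hU
    · rw [hU]
    · rw [mul_zero]

lemma minBits_le_sum_of_edgeCount_le {r : ℕ} (hr : 0 < r) (hA : ∀ j, (mappers A j).card = r)
    {x : Finset (Fin K) → ℝ} (hx : ∀ U k, edgeCount (groupPairs A U k) E ≤ x U) :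
    (minBits E A T : ℝ)
      ≤ ∑ U ∈ Finset.univ.powersetCard (r + 1), ((r : ℝ) + 1) * (x U * T / r + 1) := by
  have hr' : (0 : ℝ) < r := Nat.cast_pos.2 hr
  have hbits : ∀ U k, edgeCount (groupPairs A U k) E * T ≤ r * ⌈x U * T / r⌉₊ := fun U k => by
    have hceil := (div_le_iff₀' hr').1 (Nat.le_ceil (x U * T / r))
    have hpairs := (mul_le_mul_of_nonneg_right (hx U k) T.cast_nonneg).trans hceil
    exact_mod_cast hpairs
  refine (Nat.cast_le.2 (minBits_le_sum_powersetCard hA hbits)).trans ?_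
  push_cast
  gcongr with U hU
  obtain ⟨k, -⟩ : U.Nonempty := Finset.card_pos.1 ((Finset.mem_powersetCard.1 hU).2 ▸ r.succ_pos)
  have hxU : 0 ≤ x U := (Nat.cast_nonneg _).trans (hx U k)
  exact (Nat.ceil_lt_add_one (by positivity)).le

lemma mean_minBits_le {w : Sym2 V → ℝ} (h0 : ∀ e, 0 ≤ w e) (h1 : ∀ e, w e ≤ 1) {r : ℕ}
    (hr : 0 < r) (T : ℕ) (hA : ∀ j, (mappers A j).card = r) {m : ℝ}
    (hm : ∀ U k, ∑ x ∈ groupPairs A U k, w s(x.1, x.2) ≤ m) :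
    (mean w fun E => (minBits E A T : ℝ))
      ≤ K.choose (r + 1) * ((r + 1) * ((m + K * √(2 * m)) * T / r + 1)) := by
  let dev : Finset (Fin K) → Fin K → Finset (Sym2 V) → ℝ := fun U k E =>
    |(edgeCount (groupPairs A U k) E : ℝ) - ∑ x ∈ groupPairs A U k, w s(x.1, x.2)|
  have hcount : ∀ E U k, (edgeCount (groupPairs A U k) E : ℝ) ≤ m + ∑ k, dev U k E := by
    intro E U k
    have hdev : dev U k E ≤ ∑ k, dev U k E :=
      Finset.single_le_sum (f := fun k => dev U k E) (fun k _ => abs_nonneg _) (Finset.mem_univ k)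
    linarith [hm U k, le_abs_self ((edgeCount (groupPairs A U k) E : ℝ)
      - ∑ x ∈ groupPairs A U k, w s(x.1, x.2))]
  have hmean : ∀ U, ∑ k, mean w (dev U k) ≤ K * √(2 * m) := fun U => by
    refine (Finset.sum_le_card_nsmul _ _ (√(2 * m)) fun k _ => ?_).trans_eq (by simp)
    refine (mean_abs_edgeCount_sub_le h0 h1 _).trans (Real.sqrt_le_sqrt ?_)
    linarith [hm U k]
  have hlinear : ∀ U, (mean w fun E => ((r : ℝ) + 1) * ((m + ∑ k, dev U k E) * T / r + 1))
      = (r + 1) * ((m + ∑ k, mean w (dev U k)) * T / r + 1) := fun U => by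
    have hcoeff : ∀ E, ((r : ℝ) + 1) * ((m + ∑ k, dev U k E) * T / r + 1)
        = (r + 1) * (T / r * (m + ∑ k, dev U k E) + 1) := fun E => by ring
    simp only [hcoeff, mean_const_mul, mean_add, mean_const, mean_sum]
    ring
  calc (mean w fun E => (minBits E A T : ℝ))
      ≤ mean w fun E => ∑ U ∈ Finset.univ.powersetCard (r + 1),
          ((r : ℝ) + 1) * ((m + ∑ k, dev U k E) * T / r + 1) :=
        mean_mono h0 h1 fun E => minBits_le_sum_of_edgeCount_le hr hA (hcount E)
    _ = ∑ U ∈ Finset.univ.powersetCard (r + 1),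
          ((r : ℝ) + 1) * ((m + ∑ k, mean w (dev U k)) * T / r + 1) := by
        rw [mean_sum]
        exact Finset.sum_congr rfl fun U _ => hlinear U
    _ ≤ ∑ U ∈ (Finset.univ : Finset (Fin K)).powersetCard (r + 1),
          ((r : ℝ) + 1) * ((m + K * √(2 * m)) * T / r + 1) := by
        gcongr with U
        exact hmean U
    _ = K.choose (r + 1) * ((r + 1) * ((m + K * √(2 * m)) * T / r + 1)) := by
        rw [Finset.sum_const, Finset.card_powersetCard, Finset.card_univ, Fintype.card_fin,
          nsmul_eq_mul]

end Coding

section Counting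

variable {P : ℕ → Prop} [DecidablePred P] {L c : ℕ}

lemma count_mul_of_forall_count_block (h : ∀ b, Nat.count (fun y => P (L * b + y)) L = c) (t : ℕ) :
    Nat.count P (L * t) = c * t := by
  induction t with
  | zero => simp
  | succ t ih => rw [Nat.mul_succ, Nat.count_add, ih, h, Nat.mul_succ]

lemma count_add_left_of_periodic (hP : Function.Periodic P L) (a : ℕ) :
    Nat.count (fun x => P (a + x)) L = Nat.count P L := by
  have h := Nat.count_add P a L
  rw [Nat.count_add' P a L] at h
  have hshift : Nat.count (fun x => P (x + L)) a = Nat.count P a := by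
    congr 1
    exact funext hP
  omega

lemma count_add_left_le (hL : 0 < L) (hP : Function.Periodic P L) (hc : Nat.count P L ≤ c)
    (a m : ℕ) : (Nat.count (fun x => P (a + x)) m : ℝ) ≤ m / L * c + c := by
  have hblocks : Nat.count (fun x => P (a + x)) (L * (m / L + 1)) = Nat.count P L * (m / L + 1) :=
    count_mul_of_forall_count_block (fun b => by
      simpa only [add_assoc] using count_add_left_of_periodic hP (a + L * b)) _
  have hcount : Nat.count (fun x => P (a + x)) m ≤ c * (m / L + 1) :=
    (Nat.count_monotone _ (Nat.lt_mul_div_succ m hL).le).trans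
      (hblocks.trans_le (Nat.mul_le_mul_right _ hc))
  calc (Nat.count (fun x => P (a + x)) m : ℝ) ≤ (c * (m / L + 1) : ℕ) := Nat.cast_le.2 hcount
    _ = (m / L : ℕ) * c + c := by push_cast; ring
    _ ≤ m / L * c + c := by gcongr; exact Nat.cast_div_le

end Counting

section Cyclic

variable (K r : ℕ) [NeZero K] [NeZero (K.choose r)]

/-- A periodic enumeration of the sets of `r` machines. -/
def subsetSeq (b : ℕ) : Finset (Fin K) :=
  ((Finset.univ.powersetCard r : Finset (Finset (Fin K))).equivFinOfCardEq
    (by simp : _ = K.choose r)).symm (Fin.ofNat (K.choose r) b)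

omit [NeZero K] in
lemma card_subsetSeq (b : ℕ) : (subsetSeq K r b).card = r :=
  (Finset.mem_powersetCard.1 (Subtype.prop _)).2

omit [NeZero K] in
lemma periodic_subsetSeq : Function.Periodic (subsetSeq K r) (K.choose r) := fun b => by
  have h : Fin.ofNat (K.choose r) (b + K.choose r) = Fin.ofNat (K.choose r) b := by
    ext
    simp
  rw [subsetSeq, h, subsetSeq]

omit [NeZero K] in
lemma injOn_subsetSeq : Set.InjOn (subsetSeq K r) (Set.Iio (K.choose r)) := by
  intro b hb b' hb' h
  have hval := congrArg Fin.val (Equiv.injective _ (Subtype.ext h))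
  simpa [Nat.mod_eq_of_lt hb, Nat.mod_eq_of_lt hb'] using hval

/-- The machines that Map the vertex in position `x`: along every block of `K` positions a set
of `r` machines runs through its cyclic shifts, so that all machines Map equally many vertices
of the block. -/
def cyclicMappers (x : ℕ) : Finset (Fin K) :=
  (subsetSeq K r (x / K)).map (Equiv.addRight (Fin.ofNat K x)).toEmbedding

lemma card_cyclicMappers (x : ℕ) : (cyclicMappers K r x).card = r := by
  rw [cyclicMappers, Finset.card_map, card_subsetSeq]

lemma periodic_cyclicMappers : Function.Periodic (cyclicMappers K r) (K * K.choose r) := by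
  intro x
  have hdiv : (x + K * K.choose r) / K = x / K + K.choose r :=
    Nat.add_mul_div_left _ _ (NeZero.pos K)
  have hmod : Fin.ofNat K (x + K * K.choose r) = Fin.ofNat K x := by
    ext
    simp
  rw [cyclicMappers, hdiv, hmod, periodic_subsetSeq, cyclicMappers]

lemma cyclicMappers_mul_add (b : ℕ) (s : Fin K) :
    cyclicMappers K r (K * b + s) = (subsetSeq K r b).map (Equiv.addRight s).toEmbedding := by
  have hdiv : (K * b + s) / K = b := by
    rw [Nat.mul_add_div (NeZero.pos K), Nat.div_eq_of_lt s.2, add_zero]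
  have hmod : Fin.ofNat K (K * b + s) = s := by
    ext
    simp [Nat.mod_eq_of_lt s.2]
  rw [cyclicMappers, hdiv, hmod]

lemma count_mem_cyclicMappers (k : Fin K) (t : ℕ) :
    Nat.count (fun x => k ∈ cyclicMappers K r x) (K * t) = r * t := by
  refine count_mul_of_forall_count_block (fun b => ?_) t
  rw [Nat.count_eq_card_filter_range, Finset.card_filter, Finset.sum_range, ← Finset.card_filter]
  simp only [cyclicMappers_mul_add, Finset.mem_map_equiv, Equiv.addRight_symm_apply]
  refine Eq.trans ?_ (card_subsetSeq K r b)
  exact Finset.card_equiv (Equiv.subLeft k) (by simp [sub_eq_add_neg])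

lemma count_cyclicMappers_eq_le (B : Finset (Fin K)) :
    Nat.count (fun x => cyclicMappers K r x = B) (K * K.choose r) ≤ K := by
  rw [Nat.count_eq_card_filter_range]
  refine (Finset.card_le_card_of_injOn (Fin.ofNat K) (fun _ _ => Finset.mem_univ _)
    fun x hx y hy hxy => ?_).trans_eq (Finset.card_fin K)
  simp only [Finset.coe_filter, Finset.mem_range, Set.mem_ofPred_eq] at hx hy
  have hshift : subsetSeq K r (x / K) = subsetSeq K r (y / K) := by
    have h := hx.2.trans hy.2.symm
    rwa [cyclicMappers, cyclicMappers, hxy, Finset.map_inj] at h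
  have hdiv : x / K = y / K := injOn_subsetSeq K r (Nat.div_lt_of_lt_mul hx.1)
    (Nat.div_lt_of_lt_mul hy.1) hshift
  rw [← Nat.div_add_mod x K, ← Nat.div_add_mod y K, hdiv]
  exact congrArg _ (congrArg Fin.val hxy)

omit [NeZero (K.choose r)] in
lemma count_mod_eq (k : Fin K) (t : ℕ) : Nat.count (fun x => x % K = k) (K * t) = t := by
  have h := Nat.count_modEq_card (K * t) (NeZero.pos K) k
  simpa [Nat.ModEq, Nat.mod_eq_of_lt k.2, NeZero.pos K] using h

omit [NeZero (K.choose r)] in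
lemma count_add_mod_eq_le (k : Fin K) (a m : ℕ) :
    (Nat.count (fun x => (a + x) % K = k) m : ℝ) ≤ m / K + 1 := by
  have hcount : Nat.count (fun x => x % K = k) K ≤ 1 := by simpa using (count_mod_eq K k 1).le
  have hperiodic : Function.Periodic (fun x => x % K = k) K := fun x => by simp
  simpa only [Nat.cast_one, mul_one] using
    count_add_left_le (P := fun x => x % K = k) (NeZero.pos K) hperiodic hcount a m

lemma count_add_cyclicMappers_eq_le (B : Finset (Fin K)) (a m : ℕ) :
    (Nat.count (fun x => cyclicMappers K r (a + x) = B) m : ℝ) ≤ m / K.choose r + K := by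
  have hK : (K : ℝ) ≠ 0 := NeZero.ne _
  have hperiodic : Function.Periodic (fun x => cyclicMappers K r x = B) (K * K.choose r) :=
    fun x => congrArg (· = B) (periodic_cyclicMappers K r x)
  refine (count_add_left_le (P := fun x => cyclicMappers K r x = B) (NeZero.pos _) hperiodic
    (count_cyclicMappers_eq_le K r B) a m).trans_eq ?_
  rw [Nat.cast_mul, div_mul_eq_mul_div, mul_comm (m : ℝ), mul_div_mul_left _ _ hK]

variable {n₁ n₂ : ℕ}

/-- The position of a vertex when the first cluster is listed before the second one. -/
def position : Fin n₁ ⊕ Fin n₂ → ℕ := Sum.elim (fun a => a) (fun a => n₁ + a)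

/-- The allocation of computation load `r` that spreads both the Mappers and the Reducers of
every machine evenly over the two clusters. -/
def cyclicAllocation (n₁ n₂ : ℕ) : Allocation (Fin n₁ ⊕ Fin n₂) K where
  M k := Finset.univ.filter fun v => k ∈ cyclicMappers K r (position v)
  R k := Finset.univ.filter fun v => position v % K = k

lemma mappers_cyclicAllocation (v : Fin n₁ ⊕ Fin n₂) :
    mappers (cyclicAllocation K r n₁ n₂) v = cyclicMappers K r (position v) := by
  ext k
  simp [mappers, cyclicAllocation]

section Position

variable (n₁ n₂) (P : ℕ → Prop) [DecidablePred P]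

lemma card_toLeft_filter_position :
    (Finset.univ.filter fun v : Fin n₁ ⊕ Fin n₂ => P (position v)).toLeft.card
      = Nat.count P n₁ := by
  have h : (Finset.univ.filter fun v : Fin n₁ ⊕ Fin n₂ => P (position v)).toLeft
      = Finset.univ.filter fun a : Fin n₁ => P a := by
    ext
    simp only [Finset.mem_toLeft, Finset.mem_filter_univ]
    rfl
  rw [h, Nat.count_eq_card_filter_range, Finset.card_filter, Finset.card_filter, Finset.sum_range]

lemma card_toRight_filter_position :
    (Finset.univ.filter fun v : Fin n₁ ⊕ Fin n₂ => P (position v)).toRight.card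
      = Nat.count (fun x => P (n₁ + x)) n₂ := by
  have h : (Finset.univ.filter fun v : Fin n₁ ⊕ Fin n₂ => P (position v)).toRight
      = Finset.univ.filter fun a : Fin n₂ => P (n₁ + a) := by
    ext
    simp only [Finset.mem_toRight, Finset.mem_filter_univ]
    rfl
  rw [h, Nat.count_eq_card_filter_range, Finset.card_filter, Finset.card_filter, Finset.sum_range]

lemma card_filter_position :
    (Finset.univ.filter fun v : Fin n₁ ⊕ Fin n₂ => P (position v)).card
      = Nat.count P (n₁ + n₂) := by
  rw [← Finset.card_toLeft_add_card_toRight, card_toLeft_filter_position,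
    card_toRight_filter_position, Nat.count_add]

end Position

variable {K r} in
lemma cyclicAllocation_mem_allocations (hr : 0 < r) (hK : K ∣ n₁ + n₂) (equal : Prop) :
    cyclicAllocation K r n₁ n₂ ∈ allocations (Fin n₁ ⊕ Fin n₂) K r equal := by
  obtain ⟨t, ht⟩ := hK
  have hV : Fintype.card (Fin n₁ ⊕ Fin n₂) = K * t := by simp [ht]
  have hM : ∀ k, ((cyclicAllocation K r n₁ n₂).M k).card = r * t := fun k =>
    (card_filter_position n₁ n₂ fun x => k ∈ cyclicMappers K r x).trans
      (ht ▸ count_mem_cyclicMappers K r k t)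
  have hR : ∀ k, ((cyclicAllocation K r n₁ n₂).R k).card = t := fun k =>
    (card_filter_position n₁ n₂ fun x => x % K = k).trans (ht ▸ count_mod_eq K k t)
  refine ⟨fun v => ?_, ?_, fun k l hkl => ?_, fun v => ?_, fun k => ?_, fun _ k => ?_⟩
  · obtain ⟨k, hk⟩ : (mappers (cyclicAllocation K r n₁ n₂) v).Nonempty := by
      rwa [← Finset.card_pos, mappers_cyclicAllocation, card_cyclicMappers]
    exact ⟨k, mem_mappers.1 hk⟩
  · simp only [hM, hV, Finset.sum_const, Finset.card_univ, Fintype.card_fin, smul_eq_mul,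
      mul_left_comm]
  · exact Finset.disjoint_filter.2 fun v _ hvk hvl => hkl (Fin.ext (hvk.symm.trans hvl))
  · exact ⟨⟨position v % K, Nat.mod_lt _ (NeZero.pos K)⟩, by simp [cyclicAllocation]⟩
  · rw [hR, hV]
  · rw [hM, hV, mul_left_comm]

end Cyclic

section BlockModel

/-- The expected number of ordered pairs `(i, j)` such that `{i, j}` is an edge of the stochastic
block model. -/
def expectedPairs (n₁ n₂ : ℕ) (p q : ℝ) : ℝ :=
  p * (n₁ : ℝ) ^ 2 + p * (n₂ : ℝ) ^ 2 + 2 * q * (n₁ : ℝ) * (n₂ : ℝ)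

lemma sum_sbmProb_product {n₁ n₂ : ℕ} (p q : ℝ) (R M : Finset (Fin n₁ ⊕ Fin n₂)) :
    ∑ x ∈ R ×ˢ M, sbmProb n₁ n₂ p q s(x.1, x.2)
      = p * (R.toLeft.card * M.toLeft.card + R.toRight.card * M.toRight.card)
        + q * (R.toLeft.card * M.toRight.card + R.toRight.card * M.toLeft.card) := by
  simp only [Finset.sum_product, Finset.sum_sum_eq_sum_toLeft_add_sum_toRight, sbmProb,
    Sym2.lift_mk, Sum.isLeft_inl, Sum.isLeft_inr, if_true, reduceCtorEq, if_false,
    Finset.sum_const, nsmul_eq_mul]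
  ring

lemma sum_sbmProb_product_le_of_card_le {K N n₁ n₂ : ℕ} (hK : 0 < K) (hN : 0 < N)
    (hn : 0 < n₁ + n₂) {p q : ℝ} (hq : 0 ≤ q) (hqp : q ≤ p) {R M : Finset (Fin n₁ ⊕ Fin n₂)}
    (hR₁ : (R.toLeft.card : ℝ) ≤ n₁ / K + 1) (hR₂ : (R.toRight.card : ℝ) ≤ n₂ / K + 1)
    (hM₁ : (M.toLeft.card : ℝ) ≤ n₁ / N + K) (hM₂ : (M.toRight.card : ℝ) ≤ n₂ / N + K) :
    ∑ x ∈ R ×ˢ M, sbmProb n₁ n₂ p q s(x.1, x.2)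
      ≤ expectedPairs n₁ n₂ p q / (K * N) + 4 * (K + 1) * (p * ((n₁ : ℝ) + n₂)) := by
  have hp : 0 ≤ p := hq.trans hqp
  have hsum : (1 : ℝ) ≤ (n₁ : ℝ) + n₂ := by exact_mod_cast hn
  have hdiv : ((n₁ : ℝ) + n₂) / N ≤ (n₁ : ℝ) + n₂ :=
    div_le_self (by positivity) (by exact_mod_cast hN)
  calc ∑ x ∈ R ×ˢ M, sbmProb n₁ n₂ p q s(x.1, x.2)
      ≤ p * ((n₁ / K + 1) * (n₁ / N + K) + (n₂ / K + 1) * (n₂ / N + K))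
        + q * ((n₁ / K + 1) * (n₂ / N + K) + (n₂ / K + 1) * (n₁ / N + K)) := by
        rw [sum_sbmProb_product]
        gcongr
    _ = expectedPairs n₁ n₂ p q / (K * N)
        + (p + q) * (((n₁ : ℝ) + n₂) + ((n₁ : ℝ) + n₂) / N + 2 * K * 1) := by
        rw [expectedPairs]
        field_simp
        ring
    _ ≤ expectedPairs n₁ n₂ p q / (K * N)
        + (p + p) * (((n₁ : ℝ) + n₂) + ((n₁ : ℝ) + n₂) + 2 * K * ((n₁ : ℝ) + n₂)) := by
        gcongr
    _ = expectedPairs n₁ n₂ p q / (K * N) + 4 * (K + 1) * (p * ((n₁ : ℝ) + n₂)) := by ring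

lemma sbmProb_mem_Icc {n₁ n₂ : ℕ} {p q : ℝ} (hqp : q ≤ p) (e : Sym2 (Fin n₁ ⊕ Fin n₂)) :
    sbmProb n₁ n₂ p q e ∈ Set.Icc q p := by
  induction e with
  | _ a b =>
    simp only [sbmProb, Sym2.lift_mk]
    split_ifs <;> simp [hqp]

lemma sum_groupPairs_cyclicAllocation_le {K r n₁ n₂ : ℕ} [NeZero K] [NeZero (K.choose r)]
    {p q : ℝ} (hq : 0 ≤ q) (hqp : q ≤ p) (hn : 0 < n₁ + n₂) (U : Finset (Fin K)) (k : Fin K) :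
    ∑ x ∈ groupPairs (cyclicAllocation K r n₁ n₂) U k, sbmProb n₁ n₂ p q s(x.1, x.2)
      ≤ expectedPairs n₁ n₂ p q / (K * K.choose r)
        + 4 * (K + 1) * (p * ((n₁ : ℝ) + n₂)) := by
  let M : Finset (Fin n₁ ⊕ Fin n₂) :=
    Finset.univ.filter fun v => cyclicMappers K r (position v) = U.erase k
  have hsub : groupPairs (cyclicAllocation K r n₁ n₂) U k
      ⊆ (cyclicAllocation K r n₁ n₂).R k ×ˢ M := fun x hx => by
    obtain ⟨hxR, hxM, rfl⟩ := mem_groupPairs.1 hx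
    refine Finset.mem_product.2 ⟨hxR, Finset.mem_filter.2 ⟨Finset.mem_univ _, ?_⟩⟩
    rw [Finset.erase_insert (mt mem_mappers.1 hxM), mappers_cyclicAllocation]
  refine (Finset.sum_le_sum_of_subset_of_nonneg hsub fun x _ _ =>
    hq.trans (sbmProb_mem_Icc hqp _).1).trans ?_
  apply sum_sbmProb_product_le_of_card_le (NeZero.pos K) (NeZero.pos _) hn hq hqp
  · simpa [cyclicAllocation, card_toLeft_filter_position n₁ n₂ fun x => x % K = k]
      using count_add_mod_eq_le K k 0 n₁
  · simpa [cyclicAllocation, card_toRight_filter_position n₁ n₂ fun x => x % K = k]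
      using count_add_mod_eq_le K k n₁ n₂
  · simpa [M, card_toLeft_filter_position n₁ n₂ fun x => cyclicMappers K r x = U.erase k]
      using count_add_cyclicMappers_eq_le K r (U.erase k) 0 n₁
  · simpa [M, card_toRight_filter_position n₁ n₂ fun x => cyclicMappers K r x = U.erase k]
      using count_add_cyclicMappers_eq_le K r (U.erase k) n₁ n₂

end BlockModel

section Asymptotics

lemma avgLoad_le {V : Type*} [Fintype V] [DecidableEq V] {K r T : ℕ} {w : Sym2 V → ℝ}
    (h0 : ∀ e, 0 ≤ w e) (h1 : ∀ e, w e ≤ 1) (hr : 0 < r) (hT : 0 < T) {A : Allocation V K}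
    (hA : ∀ j, (mappers A j).card = r) {m : ℝ}
    (hm : ∀ U k, ∑ x ∈ groupPairs A U k, w s(x.1, x.2) ≤ m) :
    avgLoad w A T
      ≤ K.choose (r + 1) * ((r + 1) * ((m + K * √(2 * m)) / r + 1)) / (Fintype.card V : ℝ) ^ 2 := by
  have hT1 : (1 : ℝ) ≤ T := Nat.one_le_cast.2 hT
  calc avgLoad w A T
      = (mean w fun E => (minBits E A T : ℝ)) / T / (Fintype.card V : ℝ) ^ 2 := by
        simp only [avgLoad, load, mean, Finset.sum_div, mul_div_assoc, div_div, mul_comm]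
    _ ≤ K.choose (r + 1) * ((r + 1) * ((m + K * √(2 * m)) / r + 1))
          / (Fintype.card V : ℝ) ^ 2 := by
        gcongr
        rw [div_le_iff₀ (by linarith)]
        calc (mean w fun E => (minBits E A T : ℝ))
            ≤ K.choose (r + 1) * ((r + 1) * ((m + K * √(2 * m)) * T / r + 1)) :=
              mean_minBits_le h0 h1 hr T hA hm
          _ ≤ K.choose (r + 1) * ((r + 1) * ((m + K * √(2 * m)) * T / r + T)) := by gcongr
          _ = K.choose (r + 1) * ((r + 1) * ((m + K * √(2 * m)) / r + 1)) * T := by ring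

lemma sbmOptLoad_le {K r T n₁ n₂ : ℕ} {p q : ℝ} (hr : 0 < r) (hrK : r ≤ K) (hT : 0 < T)
    (hq : 0 ≤ q) (hqp : q ≤ p) (hp : p ≤ 1) (hn : 0 < n₁ + n₂) (hK : K ∣ n₁ + n₂) (equal : Prop)
    {m : ℝ} (hm : expectedPairs n₁ n₂ p q / (K * K.choose r)
      + 4 * (K + 1) * (p * ((n₁ : ℝ) + n₂)) = m) :
    sbmOptLoad n₁ n₂ p q K r T equal
      ≤ K.choose (r + 1) * ((r + 1) * ((m + K * √(2 * m)) / r + 1)) / ((n₁ : ℝ) + n₂) ^ 2 := by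
  have : NeZero K := ⟨by omega⟩
  have : NeZero (K.choose r) := ⟨(Nat.choose_pos hrK).ne'⟩
  have h0 : ∀ e, 0 ≤ sbmProb n₁ n₂ p q e := fun e => hq.trans (sbmProb_mem_Icc hqp e).1
  have h1 : ∀ e, sbmProb n₁ n₂ p q e ≤ 1 := fun e => (sbmProb_mem_Icc hqp e).2.trans hp
  have havg : avgLoad (sbmProb n₁ n₂ p q) (cyclicAllocation K r n₁ n₂) T ≤ _ :=
    avgLoad_le h0 h1 hr hT
      (fun j => by rw [mappers_cyclicAllocation, card_cyclicMappers])
      (fun U k => hm ▸ sum_groupPairs_cyclicAllocation_le hq hqp hn U k)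
  refine (optLoad_le_avgLoad h0 h1 (cyclicAllocation_mem_allocations hr hK equal)).trans ?_
  simpa using havg

/-- The upper bound on `L*(r)` relative to the density `D / n²` of the block model, where `D` is
the expected number of ordered pairs, in terms of `x = p n / D` and `y = 1 / D`. -/
def rateBound (K r : ℕ) (x y : ℝ) : ℝ :=
  K.choose (r + 1) * ((r + 1) * ((1 / (K * K.choose r) + 4 * (K + 1) * x
    + K * √(2 * (1 / (K * K.choose r) + 4 * (K + 1) * x) * y)) / r + y))

lemma rateBound_zero_zero {K r : ℕ} (hr : 0 < r) (hrK : r ≤ K) :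
    rateBound K r 0 0 = 1 / r * (1 - r / K) := by
  have hchoose : (K.choose (r + 1) : ℝ) * (r + 1) = K.choose r * (K - r) := by
    rw [← Nat.cast_sub hrK]
    exact_mod_cast Nat.choose_succ_right_eq K r
  have hr0 : (r : ℝ) ≠ 0 := Nat.cast_ne_zero.2 hr.ne'
  have hK0 : (K : ℝ) ≠ 0 := Nat.cast_ne_zero.2 (hr.trans_le hrK).ne'
  have hN0 : (K.choose r : ℝ) ≠ 0 := Nat.cast_ne_zero.2 (Nat.choose_pos hrK).ne'
  rw [rateBound, ← mul_assoc, hchoose]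
  simp only [mul_zero, add_zero, Real.sqrt_zero]
  field_simp

lemma tendsto_rateBound {ι : Type*} {l : Filter ι} {K r : ℕ} (hr : 0 < r) (hrK : r ≤ K)
    {x y : ι → ℝ} (hx : Tendsto x l (𝓝 0)) (hy : Tendsto y l (𝓝 0)) :
    Tendsto (fun i => rateBound K r (x i) (y i)) l (𝓝 (1 / r * (1 - r / K))) := by
  have hcont : Continuous fun z : ℝ × ℝ => rateBound K r z.1 z.2 := by
    unfold rateBound
    fun_prop
  simpa only [Function.comp_def, rateBound_zero_zero hr hrK] using
    (hcont.tendsto (0, 0)).comp (hx.prodMk_nhds hy)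

lemma sbmOptLoad_div_le_rateBound {K r T n₁ n₂ : ℕ} {p q : ℝ} (hr : 0 < r) (hrK : r ≤ K)
    (hT : 0 < T) (hq : 0 ≤ q) (hqp : q ≤ p) (hp : p ≤ 1) (hn : 0 < n₁ + n₂) (hK : K ∣ n₁ + n₂)
    (equal : Prop) (hD : 0 < expectedPairs n₁ n₂ p q) :
    sbmOptLoad n₁ n₂ p q K r T equal / (expectedPairs n₁ n₂ p q / ((n₁ : ℝ) + n₂) ^ 2)
      ≤ rateBound K r (p * ((n₁ : ℝ) + n₂) / expectedPairs n₁ n₂ p q)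
          (1 / expectedPairs n₁ n₂ p q) := by
  have hle := sbmOptLoad_le hr hrK hT hq hqp hp hn hK equal rfl
  have hn0 : (0 : ℝ) < (n₁ : ℝ) + n₂ := by exact_mod_cast hn
  set D := expectedPairs n₁ n₂ p q
  set m := D / (K * K.choose r) + 4 * (K + 1) * (p * ((n₁ : ℝ) + n₂)) with hm
  have hmean : 1 / (K * K.choose r) + 4 * (K + 1) * (p * ((n₁ : ℝ) + n₂) / D) = m / D := by
    rw [hm]
    field_simp
  have hsqrt : √(2 * (m / D) * (1 / D)) = √(2 * m) / D := by
    rw [← mul_div_assoc 2, div_mul_div_comm, mul_one, ← sq, Real.sqrt_div' _ (sq_nonneg _),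
      Real.sqrt_sq hD.le]
  rw [div_le_iff₀ (by positivity), rateBound, hmean, hsqrt]
  refine hle.trans_eq ?_
  field_simp

lemma mul_sq_div_two_le_expectedPairs (n₁ n₂ : ℕ) {p q : ℝ} (hp : 0 ≤ p) (hq : 0 ≤ q) :
    p * ((n₁ : ℝ) + n₂) ^ 2 / 2 ≤ expectedPairs n₁ n₂ p q := by
  have hcross : 0 ≤ 2 * q * (n₁ : ℝ) * (n₂ : ℝ) := by positivity
  have hsq : 0 ≤ p * ((n₁ : ℝ) - n₂) ^ 2 := by positivity
  rw [expectedPairs]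
  linarith

lemma expectedPairs_pos {n₁ n₂ : ℕ} {p q : ℝ} (hp : 0 < p) (hq : 0 ≤ q) (hn : 0 < n₁ + n₂) :
    0 < expectedPairs n₁ n₂ p q := by
  have hn0 : (0 : ℝ) < (n₁ : ℝ) + n₂ := by exact_mod_cast hn
  exact lt_of_lt_of_le (by positivity) (mul_sq_div_two_le_expectedPairs n₁ n₂ hp.le hq)

section Limits

variable {l : Filter ℕ} {n₁ n₂ : ℕ → ℕ} {p q : ℕ → ℝ}

lemma tendsto_mul_div_expectedPairs (hl : l ≤ atTop) (hn : ∀ n, n₁ n + n₂ n = n)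
    (hp : ∀ n, 0 < p n) (hq : ∀ n, 0 ≤ q n) :
    Tendsto (fun n => p n * ((n₁ n : ℝ) + n₂ n) / expectedPairs (n₁ n) (n₂ n) (p n) (q n)) l
      (𝓝 0) := by
  have hlim : Tendsto (fun n : ℕ => 2 * (1 / (n : ℝ))) l (𝓝 0) := by
    simpa using ((tendsto_one_div_atTop_nhds_zero_nat (𝕜 := ℝ)).mono_left hl).const_mul 2
  have hpos : ∀ᶠ n in l, 0 < n := (eventually_gt_atTop 0).filter_mono hl
  have hsum : ∀ n, (n₁ n : ℝ) + n₂ n = n := fun n => by exact_mod_cast hn n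
  refine squeeze_zero' (hpos.mono fun n hn0 => ?_) (hpos.mono fun n hn0 => ?_) hlim
  all_goals have hD := expectedPairs_pos (hp n) (hq n) (hn0.trans_eq (hn n).symm)
  · have := hp n
    positivity
  · have hle := mul_sq_div_two_le_expectedPairs (n₁ n) (n₂ n) (hp n).le (hq n)
    rw [hsum] at hle ⊢
    rw [div_le_iff₀ hD]
    calc p n * n = 2 * (1 / n) * (p n * (n : ℝ) ^ 2 / 2) := by field_simp
      _ ≤ 2 * (1 / n) * expectedPairs (n₁ n) (n₂ n) (p n) (q n) := by gcongr

lemma tendsto_one_div_expectedPairs (hl : l ≤ atTop) (hn : ∀ n, n₁ n + n₂ n = n)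
    (hp : ∀ n, 0 < p n) (hq : ∀ n, 0 ≤ q n)
    (hpω : (fun n : ℕ => 1 / (n : ℝ) ^ 2) =o[l] p) :
    Tendsto (fun n => 1 / expectedPairs (n₁ n) (n₂ n) (p n) (q n)) l (𝓝 0) := by
  have hlim : Tendsto (fun n : ℕ => 2 * (1 / (n : ℝ) ^ 2 / p n)) l (𝓝 0) := by
    simpa using hpω.tendsto_div_nhds_zero.const_mul 2
  have hpos : ∀ᶠ n in l, 0 < n := (eventually_gt_atTop 0).filter_mono hl
  have hsum : ∀ n, (n₁ n : ℝ) + n₂ n = n := fun n => by exact_mod_cast hn n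
  refine squeeze_zero' (hpos.mono fun n hn0 => ?_) (hpos.mono fun n hn0 => ?_) hlim
  all_goals have hD := expectedPairs_pos (hp n) (hq n) (hn0.trans_eq (hn n).symm)
  · positivity
  · have hpn := hp n
    have hle := mul_sq_div_two_le_expectedPairs (n₁ n) (n₂ n) hpn.le (hq n)
    rw [hsum] at hle
    rw [div_le_iff₀ hD]
    calc 1 = 2 * (1 / (n : ℝ) ^ 2 / p n) * (p n * (n : ℝ) ^ 2 / 2) := by field_simp
      _ ≤ 2 * (1 / (n : ℝ) ^ 2 / p n) * expectedPairs (n₁ n) (n₂ n) (p n) (q n) := by gcongr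

end Limits

lemma neBot_atTopDvd {K : ℕ} (hK : 0 < K) : (atTopDvd K).NeBot := by
  rw [atTopDvd, ← frequently_mem_iff_neBot, frequently_atTop]
  exact fun a => ⟨K * a, Nat.le_mul_of_pos_left a hK, K.dvd_mul_right a⟩

lemma eventually_atTopDvd (K : ℕ) : ∀ᶠ n in atTopDvd K, 0 < n ∧ K ∣ n :=
  ((eventually_gt_atTop 0).filter_mono inf_le_left).and (mem_inf_of_right (mem_principal_self _))

lemma le_sbmOptLoad {K r T n₁ n₂ : ℕ} {p q : ℝ} (hr : 0 < r) (hrK : r ≤ K) (hT : 0 < T)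
    (hq : 0 ≤ q) (hqp : q ≤ p) (hp : p ≤ 1) (hn : 0 < n₁ + n₂) (hK : K ∣ n₁ + n₂)
    (equal : Prop) : q * (1 / r * (1 - r / K)) ≤ sbmOptLoad n₁ n₂ p q K r T equal := by
  have : NeZero K := ⟨by omega⟩
  have : NeZero (K.choose r) := ⟨(Nat.choose_pos hrK).ne'⟩
  have : Nonempty (Fin n₁ ⊕ Fin n₂) := Fintype.card_pos_iff.1 (by simpa using hn)
  exact le_optLoad hq (fun e => (sbmProb_mem_Icc hqp e).1)
    (fun e => (sbmProb_mem_Icc hqp e).2.trans hp) hr hT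
    ⟨_, cyclicAllocation_mem_allocations hr hK equal⟩

end Asymptotics

end GraphMapReduce

end

theorem theorem3_general (K r : ℕ) (hr : 1 ≤ r) (hrK : r ≤ K) (equal : Prop)
    (n₁ n₂ T : ℕ → ℕ) (p q : ℕ → ℝ)
    (hn : ∀ n, n₁ n + n₂ n = n)
    (hT : ∀ n, 1 ≤ T n)
    (hq : ∀ n, 0 < q n) (hqp : ∀ n, q n ≤ p n) (hp : ∀ n, p n ≤ 1)
    (hpω : (fun n : ℕ => 1 / (n : ℝ) ^ 2) =o[GraphMapReduce.atTopDvd K] p) :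
    limsup (fun n : ℕ =>
        ((GraphMapReduce.sbmOptLoad (n₁ n) (n₂ n) (p n) (q n) K r (T n) equal /
          ((p n * (n₁ n : ℝ) ^ 2 + p n * (n₂ n : ℝ) ^ 2 + 2 * q n * (n₁ n : ℝ) * (n₂ n : ℝ)) /
            ((n₁ n : ℝ) + (n₂ n : ℝ)) ^ 2) : ℝ) : EReal))
        (GraphMapReduce.atTopDvd K)
      ≤ ((1 / (r : ℝ) * (1 - (r : ℝ) / (K : ℝ)) : ℝ) : EReal) ∧
    ∀ n, 0 < n → K ∣ n →
      GraphMapReduce.sbmOptLoad (n₁ n) (n₂ n) (p n) (q n) K r (T n) equal / q n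
        ≥ 1 / (r : ℝ) * (1 - (r : ℝ) / (K : ℝ)) := by
  have hp0 : ∀ n, 0 < p n := fun n => (hq n).trans_le (hqp n)
  refine ⟨?_, fun n hn0 hKn => ?_⟩
  · have := GraphMapReduce.neBot_atTopDvd (hr.trans hrK)
    have hle : GraphMapReduce.atTopDvd K ≤ atTop := inf_le_left
    have hlim := GraphMapReduce.tendsto_rateBound hr hrK
      (GraphMapReduce.tendsto_mul_div_expectedPairs hle hn hp0 fun n => (hq n).le)
      (GraphMapReduce.tendsto_one_div_expectedPairs hle hn hp0 (fun n => (hq n).le) hpω)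
    rw [← ((continuous_coe_real_ereal.tendsto _).comp hlim).limsup_eq]
    refine limsup_le_limsup ((GraphMapReduce.eventually_atTopDvd K).mono fun n hnK => ?_)
    rw [← hn n] at hnK
    exact EReal.coe_le_coe_iff.2 <| GraphMapReduce.sbmOptLoad_div_le_rateBound hr hrK (hT n)
      (hq n).le (hqp n) (hp n) hnK.1 hnK.2 equal
      (GraphMapReduce.expectedPairs_pos (hp0 n) (hq n).le hnK.1)
  · rw [ge_iff_le, le_div_iff₀' (hq n)]
    rw [← hn n] at hn0 hKn
    exact GraphMapReduce.le_sbmOptLoad hr hrK (hT n) (hq n).le (hqp n) (hp n) hn0 hKn equal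

theorem theorem3 (K r : ℕ) (hr : 1 ≤ r) (hrK : r ≤ K) (equal : Prop)
    (n₁ n₂ T : ℕ → ℕ) (p q : ℕ → ℝ)
    (hn : ∀ n, n₁ n + n₂ n = n)
    (hT : ∀ n, 1 ≤ T n)
    (hq : ∀ n, 0 < q n) (hqp : ∀ n, q n < p n) (hp : ∀ n, p n ≤ 1)
    (hn₁ : (fun n => (n₁ n : ℝ)) =Θ[GraphMapReduce.atTopDvd K] (fun n => (n : ℝ)))
    (hn₂ : (fun n => (n₂ n : ℝ)) =Θ[GraphMapReduce.atTopDvd K] (fun n => (n : ℝ)))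
    (hpω : (fun n : ℕ => 1 / (n : ℝ) ^ 2) =o[GraphMapReduce.atTopDvd K] p)
    (hqω : (fun n : ℕ => 1 / (n : ℝ) ^ 2) =o[GraphMapReduce.atTopDvd K] q) :
    limsup (fun n : ℕ =>
        ((GraphMapReduce.sbmOptLoad (n₁ n) (n₂ n) (p n) (q n) K r (T n) equal /
          ((p n * (n₁ n : ℝ) ^ 2 + p n * (n₂ n : ℝ) ^ 2 + 2 * q n * (n₁ n : ℝ) * (n₂ n : ℝ)) /
            ((n₁ n : ℝ) + (n₂ n : ℝ)) ^ 2) : ℝ) : EReal))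
        (GraphMapReduce.atTopDvd K)
      ≤ ((1 / (r : ℝ) * (1 - (r : ℝ) / (K : ℝ)) : ℝ) : EReal) ∧
    ∀ n, 0 < n → K ∣ n →
      GraphMapReduce.sbmOptLoad (n₁ n) (n₂ n) (p n) (q n) K r (T n) equal / q n
        ≥ 1 / (r : ℝ) * (1 - (r : ℝ) / (K : ℝ)) :=
  theorem3_general K r hr hrK equal n₁ n₂ T p q hn hT hq (fun n => (hqp n).le) hp hpω
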